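/- **Theorem 3.5.** For every $\Lambda\ge 1$ and every real $p>0$ there is a constant $\epsilon=\epsilon(\Lambda,p)>0$ such that the following holds. Let $(M^n,g)$ be a complete connected smooth Riemannian manifold, of any dimension $n$, which is $(\Lambda,1)$-regular, i.e. for all $x\in M$, $r>0$ and $\varepsilon\in(0,1)$, $$\sup_{B(x,\varepsilon r)}|\mathrm{Rm}|\le \frac1{r^2}\quad\Longrightarrow\quad \sup_{B(x,\frac{\varepsilon}{2}r)}|\nabla \mathrm{Rm}|\le\frac{\Lambda}{\varepsilon r\cdot r^2}.$$ Here $\mathrm{Rm}$ is the Riemann curvature tensor, $\nabla$ the Levi-Civita connection, $|\cdot|$ the tensor norm induced by $g$ (the square root of the sum of the squares of the components in an orthonormal basis), and $B(x,r)$ the open geodesic ball. For $x\in M$ and $r>0$ put $$\mathcal M(x,r):=\sup_{B\subset B(x,r)}\left(\frac{r(B)^{2p}}{\operatorname{vol}B}\int_B|\mathrm{Rm}|^p\,d\mathrm{vol}_g\right)^{1/p}\in[0,\infty],$$ where $B=B(z,s)$ runs over all geodesic balls, with $z\in M$ and radius $r(B)=s>0$, that are contained in $B(x,r)$. If for some $x\in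 M$ and $r>0$ $$\mathcal M(x,r)\le\epsilon,$$ then $$\sup_{B(x,\frac r2)}|\mathrm{Rm}|\le\frac{16}{\epsilon\, r^2}\,\mathcal M(x,r).$$ -/

import Mathlib

open MeasureTheory Bundle
open scoped ENNReal Manifold ContDiff

namespace RiemannCoord

/-! ### Tensor calculus in a coordinate domain of `ℝⁿ`

A metric is a matrix field `g`, and a covariant `k`-tensor field `T` is given by its components
`T I`, one function for every multi-index `I = (i₁, …, i_k)`. -/

variable {n : ℕ}

/-- The partial derivative `∂ᵢ f`. -/
noncomputable def partialDeriv (i : Fin n) (f : EuclideanSpace ℝ (Fin n) → ℝ) :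
    EuclideanSpace ℝ (Fin n) → ℝ :=
  fun y => fderiv ℝ f y (EuclideanSpace.single i 1)

/-- Christoffel symbols of the Levi-Civita connection,
`Γᵏᵢⱼ = ½ ∑ₗ gᵏˡ (∂ᵢ gⱼₗ + ∂ⱼ gᵢₗ - ∂ₗ gᵢⱼ)`. -/
noncomputable def christoffel (g : EuclideanSpace ℝ (Fin n) → Matrix (Fin n) (Fin n) ℝ)
    (k i j : Fin n) : EuclideanSpace ℝ (Fin n) → ℝ :=
  fun y => (1 / 2 : ℝ) * ∑ l, (g y)⁻¹ k l *
    (partialDeriv i (fun z => g z j l) y + partialDeriv j (fun z => g z i l) y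
      - partialDeriv l (fun z => g z i j) y)

/-- The components `Rˡᵢⱼₖ` of the curvature, `R(∂ᵢ, ∂ⱼ) ∂ₖ = ∑ₗ Rˡᵢⱼₖ ∂ₗ`, where
`R(X, Y) = ∇_X ∇_Y - ∇_Y ∇_X - ∇_[X, Y]`. -/
noncomputable def curvature (g : EuclideanSpace ℝ (Fin n) → Matrix (Fin n) (Fin n) ℝ)
    (l i j k : Fin n) : EuclideanSpace ℝ (Fin n) → ℝ :=
  fun y => partialDeriv i (christoffel g l j k) y - partialDeriv j (christoffel g l i k) y
    + ∑ m, (christoffel g l i m y * christoffel g m j k y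
      - christoffel g l j m y * christoffel g m i k y)

/-- The Riemann curvature tensor as a covariant 4-tensor,
`Rm(∂ᵢ, ∂ⱼ, ∂ₖ, ∂ₗ) = g(R(∂ᵢ, ∂ⱼ) ∂ₖ, ∂ₗ)`. -/
noncomputable def riemann (g : EuclideanSpace ℝ (Fin n) → Matrix (Fin n) (Fin n) ℝ)
    (I : Fin 4 → Fin n) : EuclideanSpace ℝ (Fin n) → ℝ :=
  fun y => ∑ m, g y (I 3) m * curvature g m (I 0) (I 1) (I 2) y

/-- The covariant derivative of a covariant `k`-tensor field; the new index comes first: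
`(∇T)(m, i₁, …, i_k) = ∂ₘ T(i₁, …, i_k) - ∑ₐ ∑_b Γᵇₘᵢₐ T(i₁, …, b, …, i_k)`,
with `b` in place of `iₐ`. -/
noncomputable def nabla (g : EuclideanSpace ℝ (Fin n) → Matrix (Fin n) (Fin n) ℝ) {k : ℕ}
    (T : (Fin k → Fin n) → EuclideanSpace ℝ (Fin n) → ℝ)
    (J : Fin (k + 1) → Fin n) : EuclideanSpace ℝ (Fin n) → ℝ :=
  fun y => partialDeriv (J 0) (T (Fin.tail J)) y
    - ∑ a : Fin k, ∑ b : Fin n,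
        christoffel g b (J 0) (Fin.tail J a) y * T (Function.update (Fin.tail J) a b) y

/-- The iterated covariant derivative `∇ʲ Rm`, a covariant `(4 + j)`-tensor. -/
noncomputable def nablaRiemann (g : EuclideanSpace ℝ (Fin n) → Matrix (Fin n) (Fin n) ℝ) :
    (j : ℕ) → (Fin (4 + j) → Fin n) → EuclideanSpace ℝ (Fin n) → ℝ
  | 0 => riemann g
  | j + 1 => nabla g (nablaRiemann g j)

/-- The norm of a covariant `k`-tensor with respect to the scalar product with matrix `g`,
`|T|² = ∑_{I, J} g^{i₁j₁} ⋯ g^{i_k j_k} T(I) T(J)`; this is the sum of the squares of the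
components of `T` in a `g`-orthonormal basis. -/
noncomputable def tensorNorm (g : Matrix (Fin n) (Fin n) ℝ) {k : ℕ}
    (T : (Fin k → Fin n) → ℝ) : ℝ :=
  Real.sqrt (∑ I : Fin k → Fin n, ∑ J : Fin k → Fin n, (∏ a, g⁻¹ (I a) (J a)) * T I * T J)

end RiemannCoord

namespace RiemannManifold

section

variable {n : ℕ} {M : Type*} [TopologicalSpace M] [ChartedSpace (EuclideanSpace ℝ (Fin n)) M]
  [RiemannianBundle (fun x : M => TangentSpace (𝓡 n) x)]

/-- The coordinate vector field `∂ᵢ` of the chart at `c`, as a function of the coordinates `y`. -/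
noncomputable def coordVector (c : M) (i : Fin n) (y : EuclideanSpace ℝ (Fin n)) :
    TangentSpace (𝓡 n) ((extChartAt (𝓡 n) c).symm y) :=
  mfderiv (𝓡 n) (𝓡 n) (extChartAt (𝓡 n) c).symm y
    (EuclideanSpace.single i 1 : EuclideanSpace ℝ (Fin n))

/-- The matrix `gᵢⱼ = g(∂ᵢ, ∂ⱼ)` of the metric in the chart at `c`, as a function of the
coordinates `y`; meaningful for `y` in the target of the chart. -/
noncomputable def chartMetric (c : M) (y : EuclideanSpace ℝ (Fin n)) :
    Matrix (Fin n) (Fin n) ℝ :=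
  Matrix.of fun i j => inner ℝ (coordVector c i y) (coordVector c j y)

/-- The pointwise norm `|∇ʲ Rm|(x)`, computed in the preferred chart at `x` (it does not depend
on the chart, the quantity being a tensor norm). For `j = 0` this is `|Rm|(x)`. -/
noncomputable def nablaRmNorm (j : ℕ) (x : M) : ℝ :=
  RiemannCoord.tensorNorm (chartMetric x (extChartAt (𝓡 n) x x))
    (fun I => RiemannCoord.nablaRiemann (chartMetric x) j I (extChartAt (𝓡 n) x x))

/-- The norm `|Rm|(x)` of the Riemann curvature tensor. -/
noncomputable def rmNorm (x : M) : ℝ := nablaRmNorm (n := n) 0 x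

/-- The measure `√(det gᵢⱼ) dy` of the chart at `c`, transported to `M`; it is carried by the
domain of the chart. -/
noncomputable def chartVolume [MeasurableSpace M] (c : M) : Measure M :=
  ((volume.restrict (extChartAt (𝓡 n) c).target).withDensity
    (fun y => ENNReal.ofReal (Real.sqrt (chartMetric c y).det))).map (extChartAt (𝓡 n) c).symm

variable (n M) in
/-- The Riemannian volume measure. By the change of variables formula the measures
`chartVolume c` agree on the overlaps of the charts; their supremum is the measure on `M` obtained
by gluing them. -/
noncomputable def riemannianVolume [MeasurableSpace M] : Measure M :=
  ⨆ c : M, chartVolume (n := n) c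

end

section

variable (n : ℕ) (M : Type*) [MetricSpace M] [ChartedSpace (EuclideanSpace ℝ (Fin n)) M]
  [RiemannianBundle (fun x : M => TangentSpace (𝓡 n) x)]

/-- `(Λ, k)` regularity of a Riemannian manifold: for all `x`, `r > 0` and `ε ∈ (0, 1)`, if
`|Rm| ≤ 1 / r²` on `B(x, ε r)`, then `|∇ʲ Rm| ≤ Λ / ((ε r)ʲ r²)` on `B(x, ε r / 2)`
for `j = 1, …, k`. -/
def IsRegular (Λ : ℝ) (k : ℕ) : Prop :=
  ∀ (x : M) (r ε : ℝ), 0 < r → 0 < ε → ε < 1 →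
    (⨆ y ∈ Metric.ball x (ε * r), ENNReal.ofReal (rmNorm (n := n) y)) ≤
      ENNReal.ofReal (1 / r ^ 2) →
    ∀ j : ℕ, 1 ≤ j → j ≤ k →
      (⨆ y ∈ Metric.ball x (ε / 2 * r), ENNReal.ofReal (nablaRmNorm (n := n) j y)) ≤
        ENNReal.ofReal (Λ / ((ε * r) ^ j * r ^ 2))

variable {M}

/-- The supremum over all geodesic balls `B = B(z, s)` contained in `B(x, r)` of
`(s²ᵖ / vol B · ∫_B |Rm|ᵖ)^(1/p)`, a value in `[0, ∞]`. -/
noncomputable def curvatureSup [MeasurableSpace M] (p : ℝ) (x : M) (r : ℝ) : ℝ≥0∞ :=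
  ⨆ (z : M) (s : ℝ) (_ : 0 < s) (_ : Metric.ball z s ⊆ Metric.ball x r),
    (ENNReal.ofReal (s ^ (2 * p)) / riemannianVolume n M (Metric.ball z s) *
      ∫⁻ y in Metric.ball z s, ENNReal.ofReal (rmNorm (n := n) y ^ p) ∂(riemannianVolume n M))
        ^ (1 / p)

end

end RiemannManifold

set_option synthInstance.maxHeartbeats 400000
set_option linter.unusedSectionVars false

/-! The proof is a point-selection argument. Put ε = 1/(2000Λ²), m = 𝓜(x, r), and let c maximise (r
- d(z, x))²|Rm|(z) over the closed ball; the maximum exists because closed balls are compact and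
|Rm| is continuous. Write F = |Rm|(c), ρ = r - d(c, x) and σ = min(ρ/2, 1/(3√F)). On B(c, σ) the
weight is at least half of ρ, so maximality gives |Rm| ≤ 4F there. Regularity at this scale gives
|∇Rm| ≤ 4ΛF/σ on B(c, σ/2), hence |Rm| ≥ F/2 on B(c, σ/(8Λ)). Testing 𝓜 on that ball yields σ²F ≤
128Λ²m. If σ = ρ/2, this is ρ²F ≤ 512Λ²m; if σ = 1/(3√F), it reads 1/9 ≤ 128Λ²m, which the smallness
of m forbids. So (r - d)²|Rm| ≤ 512Λ²m on B(x, r), and on B(x, r/2) the weight is at least (r/2)².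
This is `IsRegular.half_le_rmNorm` and `IsRegular.sq_mul_rmNorm_le`.

Most of the work is the geometry behind this. |Rm| is defined in a chart that varies with the point,
so its continuity rests on the tensoriality of curvature (`christoffel_change`, `curv_change`,
`tensorNorm_riemann_eq`). Metric compatibility and Cauchy-Schwarz bound the derivative of |Rm|² by
2|Rm||∇Rm| (`exists_hasFDerivAt_norm_sq_le`), and integration along almost minimal curves gives
`rmNorm_le_add_mul`. Here ∇Rm is only evaluated at the centre of its own chart, so its independence
of the chart is never needed. Finally, balls have positive finite volume: local finiteness comes
from the change of variables formula, compactness from Hopf-Rinow. -/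

namespace RiemannCoord

variable {n : ℕ}

/-! ### Tensor powers of matrices -/

/-- The `k`-fold tensor power of a matrix, indexed by multi-indices. -/
def tensorPow (B : Matrix (Fin n) (Fin n) ℝ) (k : ℕ) :
    Matrix (Fin k → Fin n) (Fin k → Fin n) ℝ :=
  Matrix.of fun K I => ∏ a, B (K a) (I a)

lemma tensorPow_apply (B : Matrix (Fin n) (Fin n) ℝ) {k : ℕ} (K I : Fin k → Fin n) :
    tensorPow B k K I = ∏ a, B (K a) (I a) := rfl

/-- A product of sums over single indices expands into a sum over multi-indices. Multiplicativity
reduces identities between tensor powers to identities between n × n matrices. -/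
lemma tensorPow_mul (B C : Matrix (Fin n) (Fin n) ℝ) (k : ℕ) :
    tensorPow (B * C) k = tensorPow B k * tensorPow C k := by
  ext K I
  simp only [tensorPow_apply, Matrix.mul_apply, Finset.prod_univ_sum, Fintype.piFinset_univ,
    Finset.prod_mul_distrib]

lemma tensorPow_transpose (B : Matrix (Fin n) (Fin n) ℝ) (k : ℕ) :
    tensorPow B.transpose k = (tensorPow B k).transpose := rfl

lemma tensorNorm_eq_sqrt_dotProduct (g : Matrix (Fin n) (Fin n) ℝ) {k : ℕ}
    (T : (Fin k → Fin n) → ℝ) :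
    tensorNorm g T = √(T ⬝ᵥ (tensorPow g⁻¹ k).mulVec T) := by
  rw [tensorNorm]
  congr 1
  simp only [dotProduct, Matrix.mulVec, Finset.mul_sum, tensorPow_apply]
  refine Finset.sum_congr rfl fun I _ => Finset.sum_congr rfl fun J _ => ?_
  ring

/-- The tensor norm is invariant under a linear change of coordinates. -/
lemma tensorNorm_change (g J : Matrix (Fin n) (Fin n) ℝ) (hJ : IsUnit J.det) {k : ℕ}
    (T : (Fin k → Fin n) → ℝ) :
    tensorNorm (J.transpose * g * J) ((tensorPow J.transpose k).mulVec T) = tensorNorm g T := by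
  rw [tensorNorm_eq_sqrt_dotProduct, tensorNorm_eq_sqrt_dotProduct]
  congr 1
  have h1 : (J.transpose * g * J)⁻¹ = J⁻¹ * g⁻¹ * J.transpose⁻¹ := by
    rw [Matrix.mul_inv_rev, Matrix.mul_inv_rev, Matrix.mul_assoc]
  have hJt : IsUnit J.transpose.det := by rwa [Matrix.det_transpose]
  have h2 : tensorPow J k * tensorPow (J.transpose * g * J)⁻¹ k * tensorPow J.transpose k =
      tensorPow g⁻¹ k := by
    rw [← tensorPow_mul, ← tensorPow_mul, h1]
    congr 1
    rw [Matrix.mul_assoc, Matrix.mul_assoc, Matrix.nonsing_inv_mul _ hJt, Matrix.mul_one,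
      ← Matrix.mul_assoc, Matrix.mul_nonsing_inv _ hJ, Matrix.one_mul]
  rw [← h2, tensorPow_transpose, Matrix.mulVec_transpose, ← Matrix.mulVec_mulVec,
    ← Matrix.mulVec_mulVec, Matrix.dotProduct_mulVec T (tensorPow J k), Matrix.mulVec_transpose]

open scoped MatrixOrder in
/-- A positive definite matrix has an invertible square root of the inverse. -/
lemma exists_inv_eq_transpose_mul_self {g : Matrix (Fin n) (Fin n) ℝ} (hg : g.PosDef) :
    ∃ B : Matrix (Fin n) (Fin n) ℝ, IsUnit B.det ∧ g⁻¹ = B.transpose * B := by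
  obtain ⟨B, hB⟩ := CStarAlgebra.nonneg_iff_eq_star_mul_self.mp
    (Matrix.nonneg_iff_posSemidef.mpr hg.inv.posSemidef)
  rw [Matrix.star_eq_conjTranspose, Matrix.conjTranspose_eq_transpose_of_trivial] at hB
  refine ⟨B, ?_, hB⟩
  have h : IsUnit (g⁻¹).det := hg.inv.det_pos.ne'.isUnit
  rw [hB, Matrix.det_mul] at h
  exact isUnit_of_mul_isUnit_right h

/-- A factor B of g⁻¹ is a change to an orthonormal frame, in which the induced product of tensors
is the Euclidean one. -/
lemma tensorNorm_sq_eq_sum {g B : Matrix (Fin n) (Fin n) ℝ} (hB : g⁻¹ = B.transpose * B) {k : ℕ}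
    (S T : (Fin k → Fin n) → ℝ) :
    S ⬝ᵥ (tensorPow g⁻¹ k).mulVec T =
      ∑ K, (tensorPow B k).mulVec S K * (tensorPow B k).mulVec T K := by
  rw [hB, tensorPow_mul, tensorPow_transpose, ← Matrix.mulVec_mulVec, Matrix.dotProduct_mulVec,
    Matrix.vecMul_transpose]
  rfl

/-- Positive definiteness matters: `Real.sqrt` vanishes on negative numbers, so the quadratic form
must be nonnegative for the square to undo the root. -/
lemma tensorNorm_sq {g : Matrix (Fin n) (Fin n) ℝ} (hg : g.PosDef) {k : ℕ}
    (T : (Fin k → Fin n) → ℝ) :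
    tensorNorm g T ^ 2 = T ⬝ᵥ (tensorPow g⁻¹ k).mulVec T := by
  obtain ⟨B, -, hB⟩ := exists_inv_eq_transpose_mul_self hg
  rw [tensorNorm_eq_sqrt_dotProduct, Real.sq_sqrt]
  rw [tensorNorm_sq_eq_sum hB]
  exact Finset.sum_nonneg fun K _ => mul_self_nonneg _

lemma tensorNorm_nonneg (g : Matrix (Fin n) (Fin n) ℝ) {k : ℕ} (T : (Fin k → Fin n) → ℝ) :
    0 ≤ tensorNorm g T := Real.sqrt_nonneg _

lemma mulVec_tensorPow_cons (B : Matrix (Fin n) (Fin n) ℝ) {k : ℕ}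
    (S : (Fin (k + 1) → Fin n) → ℝ) (j : Fin n) (K : Fin k → Fin n) :
    (tensorPow B (k + 1)).mulVec S (Fin.cons j K) =
      ∑ m, B j m * (tensorPow B k).mulVec (fun I => S (Fin.cons m I)) K := by
  simp only [Matrix.mulVec, dotProduct]
  rw [← (Fin.consEquiv (fun _ => Fin n)).sum_comp, Fintype.sum_prod_type]
  refine Finset.sum_congr rfl fun m _ => ?_
  rw [Finset.mul_sum]
  refine Finset.sum_congr rfl fun I _ => ?_
  simp [tensorPow_apply, Fin.prod_univ_succ, Fin.consEquiv, mul_assoc]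

/-- Cauchy-Schwarz: the product of a `k`-tensor `T` with the contraction of a `(k + 1)`-tensor `S`
by a vector `v` is at most `|T| |S| |v|`. -/
lemma abs_dotProduct_contract_le {g : Matrix (Fin n) (Fin n) ℝ} (hg : g.PosDef) {k : ℕ}
    (T : (Fin k → Fin n) → ℝ) (S : (Fin (k + 1) → Fin n) → ℝ) (v : Fin n → ℝ) :
    |T ⬝ᵥ (tensorPow g⁻¹ k).mulVec (fun I => ∑ m, v m * S (Fin.cons m I))| ≤
      tensorNorm g T * (tensorNorm g S * √(v ⬝ᵥ g.mulVec v)) := by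
  obtain ⟨B, hBu, hB⟩ := exists_inv_eq_transpose_mul_self hg
  have hBt : IsUnit B.transpose.det := by rwa [Matrix.det_transpose]
  -- The components of v in the orthonormal frame given by B, so that |v|_g is the Euclidean norm of
  -- w.
  set w : Fin n → ℝ := (B.transpose⁻¹).mulVec v with hw
  have hwv : v = B.transpose.mulVec w := by
    rw [hw, Matrix.mulVec_mulVec, Matrix.mul_nonsing_inv _ hBt, Matrix.one_mulVec]
  have hgu : IsUnit g.det := hg.det_pos.ne'.isUnit
  have hnorm : v ⬝ᵥ g.mulVec v = ∑ j, w j ^ 2 := by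
    have hone : B * g * B.transpose = 1 := by
      have h3 : g = B⁻¹ * B.transpose⁻¹ := by
        rw [← Matrix.mul_inv_rev, ← hB, Matrix.nonsing_inv_nonsing_inv _ hgu]
      rw [h3, ← Matrix.mul_assoc, Matrix.mul_nonsing_inv _ hBu, Matrix.one_mul,
        Matrix.nonsing_inv_mul _ hBt]
    have : v ⬝ᵥ g.mulVec v = w ⬝ᵥ (B * g * B.transpose).mulVec w := by
      rw [hwv, ← Matrix.mulVec_mulVec, ← Matrix.mulVec_mulVec, Matrix.dotProduct_mulVec w B,
        Matrix.mulVec_transpose]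
    rw [this, hone, Matrix.one_mulVec]
    simp [dotProduct, sq]
  set T' := (tensorPow B k).mulVec T with hT'
  set S' := (tensorPow B (k + 1)).mulVec S with hS'
  have hT : tensorNorm g T = √(∑ K, T' K ^ 2) := by
    rw [tensorNorm_eq_sqrt_dotProduct, tensorNorm_sq_eq_sum hB]
    simp only [sq, hT']
  have hS : tensorNorm g S = √(∑ K, S' K ^ 2) := by
    rw [tensorNorm_eq_sqrt_dotProduct, tensorNorm_sq_eq_sum hB]
    simp only [sq, hS']
  have hcon : ∀ K, (tensorPow B k).mulVec (fun I => ∑ m, v m * S (Fin.cons m I)) K =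
      ∑ j, w j * S' (Fin.cons j K) := by
    intro K
    have h1 : ∀ j, S' (Fin.cons j K) =
      ∑ m, B j m * (tensorPow B k).mulVec (fun I => S (Fin.cons m I)) K :=
        fun j => mulVec_tensorPow_cons B S j K
    simp only [h1, hwv, Matrix.mulVec, dotProduct, Finset.mul_sum, Finset.sum_mul,
      Matrix.transpose_apply]
    rw [Finset.sum_comm' (t' := Finset.univ) (s' := fun _ => Finset.univ) (by simp)]
    conv_rhs => rw [Finset.sum_comm]
    refine Finset.sum_congr rfl fun m _ => ?_
    rw [Finset.sum_comm]
    refine Finset.sum_congr rfl fun j _ => ?_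
    refine Finset.sum_congr rfl fun I _ => ?_
    ring
  rw [tensorNorm_sq_eq_sum hB, hT, hS, hnorm]
  -- Cauchy-Schwarz twice: over the multi-index K here, then over the contracted index for each
  -- fixed K.
  have cs1 : |∑ K, T' K * ∑ j, w j * S' (Fin.cons j K)| ≤
      √(∑ K, T' K ^ 2) * √(∑ K, (∑ j, w j * S' (Fin.cons j K)) ^ 2) := by
    rw [← Real.sqrt_mul (Finset.sum_nonneg fun K _ => sq_nonneg _)]
    refine Real.abs_le_sqrt ?_
    exact Finset.sum_mul_sq_le_sq_mul_sq _ _ _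
  have cs2 : ∑ K, (∑ j, w j * S' (Fin.cons j K)) ^ 2 ≤ (∑ K, S' K ^ 2) * ∑ j, w j ^ 2 := by
    have : ∑ K, S' K ^ 2 = ∑ K : Fin k → Fin n, ∑ j, S' (Fin.cons j K) ^ 2 := by
      rw [← (Fin.consEquiv (fun _ => Fin n)).sum_comp, Fintype.sum_prod_type_right]
      rfl
    rw [this, Finset.sum_mul]
    refine Finset.sum_le_sum fun K _ => ?_
    rw [mul_comm]
    exact Finset.sum_mul_sq_le_sq_mul_sq _ _ _
  simp only [hcon]
  refine cs1.trans ?_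
  refine mul_le_mul_of_nonneg_left ?_ (Real.sqrt_nonneg _)
  rw [← Real.sqrt_mul (Finset.sum_nonneg fun K _ => sq_nonneg _)]
  exact Real.sqrt_le_sqrt cs2

end RiemannCoord

/-! ### Connections and curvature on a normed space -/

namespace ConnectionChange

open Filter Topology

variable {E : Type*} [NormedAddCommGroup E] [NormedSpace ℝ E]
  {F : Type*} [NormedAddCommGroup F] [NormedSpace ℝ F]

lemma fderiv_apply_apply {Γ : E → E →L[ℝ] E →L[ℝ] F} {z : E} (h : DifferentiableAt ℝ Γ z)
    (a b c : E) : fderiv ℝ (fun w => Γ w a b) z c = fderiv ℝ Γ z c a b := by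
  have h1 : HasFDerivAt (fun w => Γ w a b)
      (((fderiv ℝ Γ z).flip a).flip b) z := by
    have h2 := (h.hasFDerivAt.clm_apply (hasFDerivAt_const a z)).clm_apply (hasFDerivAt_const b z)
    convert h2 using 1
    ext u
    simp
  rw [h1.fderiv]
  rfl

/-- The curvature `R(u, v) w` of the connection with Christoffel form `Γ`. -/
noncomputable def curv (Γ : E → E →L[ℝ] E →L[ℝ] E) (z u v w : E) : E :=
  fderiv ℝ Γ z u v w - fderiv ℝ Γ z v u w + Γ z u (Γ z v w) - Γ z v (Γ z u w)

/-- Trilinearity allows curvature components to be expanded in the coordinate basis. -/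
lemma isLinearMap_curv (Γ : E → E →L[ℝ] E →L[ℝ] E) (z : E) :
    (∀ v w, IsLinearMap ℝ fun u => curv Γ z u v w) ∧
    (∀ u w, IsLinearMap ℝ fun v => curv Γ z u v w) ∧
    (∀ u v, IsLinearMap ℝ fun w => curv Γ z u v w) := by
  have a1 : ∀ a b c d, fderiv ℝ Γ z (a + b) c d = fderiv ℝ Γ z a c d + fderiv ℝ Γ z b c d := by
    intro a b c d
    rw [ContinuousLinearMap.map_add, add_apply, add_apply]
  have a2 : ∀ a b c d, fderiv ℝ Γ z c (a + b) d = fderiv ℝ Γ z c a d + fderiv ℝ Γ z c b d := by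
    intro a b c d
    rw [ContinuousLinearMap.map_add, add_apply]
  have s1 : ∀ (r : ℝ) a c d, fderiv ℝ Γ z (r • a) c d = r • fderiv ℝ Γ z a c d := by
    intro r a c d
    rw [ContinuousLinearMap.map_smul, smul_apply, smul_apply]
  have s2 : ∀ (r : ℝ) a c d, fderiv ℝ Γ z c (r • a) d = r • fderiv ℝ Γ z c a d := by
    intro r a c d
    rw [ContinuousLinearMap.map_smul, smul_apply]
  have a3 : ∀ a b c, Γ z (a + b) c = Γ z a c + Γ z b c := by
    intro a b c
    rw [ContinuousLinearMap.map_add, add_apply]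
  have s3 : ∀ (r : ℝ) a c, Γ z (r • a) c = r • Γ z a c := by
    intro r a c
    rw [ContinuousLinearMap.map_smul, smul_apply]
  refine ⟨fun _ _ => ⟨fun _ _ => ?_, fun _ _ => ?_⟩, fun _ _ => ⟨fun _ _ => ?_, fun _ _ => ?_⟩,
    fun _ _ => ⟨fun _ _ => ?_, fun _ _ => ?_⟩⟩ <;>
  · simp only [curv, a1, a2, a3, s1, s2, s3]
    simp only [ContinuousLinearMap.map_add, ContinuousLinearMap.map_smul, smul_sub, smul_add]
    try abel

lemma differentiableAt_smulRight_smulRight (p q : E →L[ℝ] ℝ) {f : E → F} {z : E}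
    (h : DifferentiableAt ℝ f z) :
    DifferentiableAt ℝ (fun w => p.smulRight (q.smulRight (f w))) z := by
  have h1 : DifferentiableAt ℝ (fun w => q.smulRight (f w)) z :=
    DifferentiableAt.comp (G := E →L[ℝ] F) z
      (ContinuousLinearMap.smulRightL ℝ E F q).differentiableAt h
  exact DifferentiableAt.comp (G := E →L[ℝ] E →L[ℝ] F) z
    (ContinuousLinearMap.smulRightL ℝ E (E →L[ℝ] F) p).differentiableAt h1

lemma differentiableAt_sum_smulRight {ι : Type*} [Fintype ι] (p : ι → E →L[ℝ] ℝ)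
    {f : E → ι → ι → F} {z : E} (h : ∀ i j, DifferentiableAt ℝ (fun w => f w i j) z) :
    DifferentiableAt ℝ (fun w => ∑ i, ∑ j, (p i).smulRight ((p j).smulRight (f w i j))) z := by
  refine DifferentiableAt.fun_sum (𝕜 := ℝ) (E := E) (F := E →L[ℝ] E →L[ℝ] F) fun i _ => ?_
  refine DifferentiableAt.fun_sum (𝕜 := ℝ) (E := E) (F := E →L[ℝ] E →L[ℝ] F) fun j _ => ?_
  exact differentiableAt_smulRight_smulRight _ _ (h i j)

/-- Product and chain rule. The two Hessian terms are the source of the inhomogeneous term in the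
transformation law of the Christoffel symbols. -/
lemma fderiv_pullback {G₁ G₂ : E → E →L[ℝ] E →L[ℝ] F} {φ : E → E} {z : E}
    (hφ : ContDiffAt ℝ 2 φ z) (hG₁ : DifferentiableAt ℝ G₁ z)
    (hG₂ : DifferentiableAt ℝ G₂ (φ z))
    (hG : ∀ᶠ w in 𝓝 z, ∀ u v, G₁ w u v = G₂ (φ w) (fderiv ℝ φ w u) (fderiv ℝ φ w v))
    (c u v : E) :
    fderiv ℝ G₁ z c u v =
      fderiv ℝ G₂ (φ z) (fderiv ℝ φ z c) (fderiv ℝ φ z u) (fderiv ℝ φ z v)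
      + G₂ (φ z) (fderiv ℝ (fderiv ℝ φ) z c u) (fderiv ℝ φ z v)
      + G₂ (φ z) (fderiv ℝ φ z u) (fderiv ℝ (fderiv ℝ φ) z c v) := by
  have hd : HasFDerivAt φ (fderiv ℝ φ z) z := (hφ.differentiableAt (by norm_num)).hasFDerivAt
  have hdd : HasFDerivAt (fderiv ℝ φ) (fderiv ℝ (fderiv ℝ φ) z) z :=
    ((hφ.fderiv_right (m := 1) (by norm_num)).differentiableAt (by norm_num)).hasFDerivAt
  have hc : HasFDerivAt (fun w => G₂ (φ w)) ((fderiv ℝ G₂ (φ z)).comp (fderiv ℝ φ z)) z :=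
    HasFDerivAt.comp (G := E →L[ℝ] E →L[ℝ] F) z hG₂.hasFDerivAt hd
  have hu := hdd.clm_apply (hasFDerivAt_const u z)
  have hv := hdd.clm_apply (hasFDerivAt_const v z)
  have h1 := (hc.clm_apply hu).clm_apply hv
  rw [← fderiv_apply_apply hG₁]
  have h2 : (fun w => G₁ w u v) =ᶠ[𝓝 z]
      fun w => G₂ (φ w) (fderiv ℝ φ w u) (fderiv ℝ φ w v) := by
    filter_upwards [hG] with w hw using hw u v
  rw [h2.fderiv_eq, h1.fderiv]
  simp
  abel

/-- The transformation law of Christoffel symbols. -/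
lemma christoffel_change {G₁ G₂ : E → E →L[ℝ] E →L[ℝ] ℝ} {φ : E → E} {z : E}
    {Γ₁ Γ₂ : E →L[ℝ] E →L[ℝ] E}
    (hφ : ContDiffAt ℝ 2 φ z) (hG₁ : DifferentiableAt ℝ G₁ z)
    (hG₂ : DifferentiableAt ℝ G₂ (φ z))
    (hG : ∀ᶠ w in 𝓝 z, ∀ u v, G₁ w u v = G₂ (φ w) (fderiv ℝ φ w u) (fderiv ℝ φ w v))
    (hsymm : ∀ u v, G₂ (φ z) u v = G₂ (φ z) v u)
    (hnondeg : ∀ u, (∀ v, G₂ (φ z) u v = 0) → u = 0)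
    (hsurj : Function.Surjective (fderiv ℝ φ z))
    (h₁ : ∀ u v w, 2 * G₁ z (Γ₁ u v) w =
      fderiv ℝ G₁ z u v w + fderiv ℝ G₁ z v u w - fderiv ℝ G₁ z w u v)
    (h₂ : ∀ u v w, 2 * G₂ (φ z) (Γ₂ u v) w =
      fderiv ℝ G₂ (φ z) u v w + fderiv ℝ G₂ (φ z) v u w - fderiv ℝ G₂ (φ z) w u v)
    (u v : E) :
    fderiv ℝ φ z (Γ₁ u v) =
      fderiv ℝ (fderiv ℝ φ) z u v + Γ₂ (fderiv ℝ φ z u) (fderiv ℝ φ z v) := by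
  have hD : ∀ a b, fderiv ℝ (fderiv ℝ φ) z a b = fderiv ℝ (fderiv ℝ φ) z b a := by
    have : IsSymmSndFDerivAt ℝ φ z := hφ.isSymmSndFDerivAt (by simp)
    exact fun a b => this a b
  rw [← sub_eq_zero]
  apply hnondeg
  intro b
  -- It suffices to test against vectors dφ(w). There the two Koszul formulas can be compared, and
  -- the Hessian terms other than D²φ(u, v) cancel by symmetry.
  obtain ⟨w, rfl⟩ := hsurj b
  have e1 := h₁ u v w
  have e2 := h₂ (fderiv ℝ φ z u) (fderiv ℝ φ z v) (fderiv ℝ φ z w)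
  rw [hG.self_of_nhds, fderiv_pullback hφ hG₁ hG₂ hG, fderiv_pullback hφ hG₁ hG₂ hG,
    fderiv_pullback hφ hG₁ hG₂ hG, hD v u, hD w u, hD w v,
    hsymm _ (fderiv ℝ (fderiv ℝ φ) z u w)] at e1
  simp only [map_sub, map_add, sub_apply, add_apply]
  linarith

/-- The curvature is a tensor. -/
lemma curv_change {Γ₁ Γ₂ : E → E →L[ℝ] E →L[ℝ] E} {φ : E → E} {z : E}
    (hφ : ContDiffAt ℝ 3 φ z) (hΓ₁ : DifferentiableAt ℝ Γ₁ z)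
    (hΓ₂ : DifferentiableAt ℝ Γ₂ (φ z))
    (hΓ : ∀ᶠ w in 𝓝 z, ∀ u v, fderiv ℝ φ w (Γ₁ w u v) =
      fderiv ℝ (fderiv ℝ φ) w u v + Γ₂ (φ w) (fderiv ℝ φ w u) (fderiv ℝ φ w v))
    (hsymm : ∀ u v, Γ₂ (φ z) u v = Γ₂ (φ z) v u) (u v w : E) :
    fderiv ℝ φ z (curv Γ₁ z u v w) =
      curv Γ₂ (φ z) (fderiv ℝ φ z u) (fderiv ℝ φ z v) (fderiv ℝ φ z w) := by
  have hφ2 : ContDiffAt ℝ 2 φ z := hφ.of_le (by norm_num)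
  have hφ' : ContDiffAt ℝ 2 (fderiv ℝ φ) z := hφ.fderiv_right (by norm_num)
  have hD : ∀ a b, fderiv ℝ (fderiv ℝ φ) z a b = fderiv ℝ (fderiv ℝ φ) z b a := by
    have : IsSymmSndFDerivAt ℝ φ z := hφ2.isSymmSndFDerivAt (by simp)
    exact fun a b => this a b
  have hD3 : ∀ a b, fderiv ℝ (fderiv ℝ (fderiv ℝ φ)) z a b =
      fderiv ℝ (fderiv ℝ (fderiv ℝ φ)) z b a := by
    have : IsSymmSndFDerivAt ℝ (fderiv ℝ φ) z := hφ'.isSymmSndFDerivAt (by simp)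
    exact fun a b => this a b
  have hd : HasFDerivAt φ (fderiv ℝ φ z) z := (hφ.differentiableAt (by norm_num)).hasFDerivAt
  have hdd : HasFDerivAt (fderiv ℝ φ) (fderiv ℝ (fderiv ℝ φ) z) z :=
    (hφ'.differentiableAt (by norm_num)).hasFDerivAt
  have hddd : HasFDerivAt (fderiv ℝ (fderiv ℝ φ)) (fderiv ℝ (fderiv ℝ (fderiv ℝ φ)) z) z :=
    ((hφ'.fderiv_right (m := 1) (by norm_num)).differentiableAt (by norm_num)).hasFDerivAt
  -- The transformation law differentiated in the direction c and solved for the term containing the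
  -- derivative of Γ₁.
  have key : ∀ c a b, fderiv ℝ φ z (fderiv ℝ Γ₁ z c a b) =
      fderiv ℝ (fderiv ℝ (fderiv ℝ φ)) z c a b
      + fderiv ℝ Γ₂ (φ z) (fderiv ℝ φ z c) (fderiv ℝ φ z a) (fderiv ℝ φ z b)
      + Γ₂ (φ z) (fderiv ℝ (fderiv ℝ φ) z c a) (fderiv ℝ φ z b)
      + Γ₂ (φ z) (fderiv ℝ φ z a) (fderiv ℝ (fderiv ℝ φ) z c b)
      - fderiv ℝ (fderiv ℝ φ) z c (Γ₁ z a b) := by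
    intro c a b
    have l := hdd.clm_apply ((hΓ₁.hasFDerivAt.clm_apply (hasFDerivAt_const a z)).clm_apply
      (hasFDerivAt_const b z))
    have r1 := (hddd.clm_apply (hasFDerivAt_const a z)).clm_apply (hasFDerivAt_const b z)
    have hc : HasFDerivAt (fun w => Γ₂ (φ w)) ((fderiv ℝ Γ₂ (φ z)).comp (fderiv ℝ φ z)) z :=
      HasFDerivAt.comp (G := E →L[ℝ] E →L[ℝ] E) z hΓ₂.hasFDerivAt hd
    have ha := hdd.clm_apply (hasFDerivAt_const a z)
    have hb := hdd.clm_apply (hasFDerivAt_const b z)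
    have r2 := (hc.clm_apply ha).clm_apply hb
    have heq : (fun w => fderiv ℝ φ w (Γ₁ w a b)) =ᶠ[𝓝 z]
        fun w => fderiv ℝ (fderiv ℝ φ) w a b
          + Γ₂ (φ w) (fderiv ℝ φ w a) (fderiv ℝ φ w b) := by
      filter_upwards [hΓ] with w hw using hw a b
    have h := (r1.add r2).congr_of_eventuallyEq heq |>.unique l
    have h2 := DFunLike.congr_fun h c
    simp at h2
    rw [eq_sub_iff_add_eq, ← h2]
    abel
  have hz := hΓ.self_of_nhds
  simp only [curv, map_sub, map_add, key, hz]
  -- After antisymmetrisation in u and v, the third derivatives cancel, and so do the mixed terms,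
  -- by symmetry of D²φ and of Γ₂.
  rw [hD3 v u, hD v u, hsymm (fderiv ℝ φ z v) (fderiv ℝ (fderiv ℝ φ) z u w),
    hsymm (fderiv ℝ φ z u) (fderiv ℝ (fderiv ℝ φ) z v w)]
  abel

end ConnectionChange

namespace RiemannCoord

variable {n : ℕ}

/-! ### Coordinate forms of the metric and of the Christoffel symbols -/

/-- Used to pass from coordinate identities to identities of multilinear forms, one slot at a time.
-/
lemma eq_of_isLinearMap_single {F : Type*} [AddCommGroup F] [Module ℝ F]
    {f g : EuclideanSpace ℝ (Fin n) → F} (hf : IsLinearMap ℝ f) (hg : IsLinearMap ℝ g)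
    (h : ∀ i, f (EuclideanSpace.single i 1) = g (EuclideanSpace.single i 1))
    (u : EuclideanSpace ℝ (Fin n)) : f u = g u := by
  have : hf.mk' f = hg.mk' g := by
    refine (EuclideanSpace.basisFun (Fin n) ℝ).toBasis.ext fun i => ?_
    simpa using h i
  exact DFunLike.congr_fun this u

/-- The coordinate functional. -/
noncomputable def coordinate (i : Fin n) : EuclideanSpace ℝ (Fin n) →L[ℝ] ℝ :=
  EuclideanSpace.proj i

lemma coordinate_apply (i : Fin n) (u : EuclideanSpace ℝ (Fin n)) : coordinate i u = u i := rfl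

/-- The bilinear map with coefficients `c i j` in the standard basis. -/
noncomputable def coeffForm {F : Type*} [NormedAddCommGroup F] [NormedSpace ℝ F]
    (c : Fin n → Fin n → F) :
    EuclideanSpace ℝ (Fin n) →L[ℝ] EuclideanSpace ℝ (Fin n) →L[ℝ] F :=
  ∑ i, ∑ j, (coordinate i).smulRight ((coordinate j).smulRight (c i j))

lemma coeffForm_apply {F : Type*} [NormedAddCommGroup F] [NormedSpace ℝ F]
    (c : Fin n → Fin n → F) (u v : EuclideanSpace ℝ (Fin n)) :
    coeffForm c u v = ∑ i, ∑ j, u i • v j • c i j := by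
  simp [coeffForm, coordinate_apply]

lemma coeffForm_single {F : Type*} [NormedAddCommGroup F] [NormedSpace ℝ F]
    (c : Fin n → Fin n → F) (i j : Fin n) :
    coeffForm c (EuclideanSpace.single i 1) (EuclideanSpace.single j 1) = c i j := by
  simp [coeffForm_apply, ite_smul]

lemma differentiableAt_coeffForm {F : Type*} [NormedAddCommGroup F] [NormedSpace ℝ F]
    {c : EuclideanSpace ℝ (Fin n) → Fin n → Fin n → F} {y : EuclideanSpace ℝ (Fin n)}
    (h : ∀ i j, DifferentiableAt ℝ (fun z => c z i j) y) :
    DifferentiableAt ℝ (fun z => coeffForm (c z)) y := by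
  exact ConnectionChange.differentiableAt_sum_smulRight coordinate h

/-- The metric as a field of bilinear forms. -/
noncomputable def metricForm (g : EuclideanSpace ℝ (Fin n) → Matrix (Fin n) (Fin n) ℝ)
    (y : EuclideanSpace ℝ (Fin n)) :
    EuclideanSpace ℝ (Fin n) →L[ℝ] EuclideanSpace ℝ (Fin n) →L[ℝ] ℝ :=
  coeffForm fun i j => g y i j

/-- The Christoffel symbols as a field of bilinear maps. -/
noncomputable def christoffelForm (g : EuclideanSpace ℝ (Fin n) → Matrix (Fin n) (Fin n) ℝ)
    (y : EuclideanSpace ℝ (Fin n)) :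
    EuclideanSpace ℝ (Fin n) →L[ℝ] EuclideanSpace ℝ (Fin n) →L[ℝ] EuclideanSpace ℝ (Fin n) :=
  coeffForm fun i j => WithLp.toLp 2 fun k => christoffel g k i j y

/-- `g` is a smooth Riemannian metric on the open set `U`. -/
structure IsMetricOn (g : EuclideanSpace ℝ (Fin n) → Matrix (Fin n) (Fin n) ℝ)
    (U : Set (EuclideanSpace ℝ (Fin n))) : Prop where
  isOpen : IsOpen U
  contDiffOn : ∀ i j, ContDiffOn ℝ ∞ (fun y => g y i j) U
  posDef : ∀ y ∈ U, (g y).PosDef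

namespace IsMetricOn

variable {g : EuclideanSpace ℝ (Fin n) → Matrix (Fin n) (Fin n) ℝ}
  {U : Set (EuclideanSpace ℝ (Fin n))} {y : EuclideanSpace ℝ (Fin n)}

lemma _root_.RiemannCoord.contDiffOn_det {m : ℕ}
    {A : EuclideanSpace ℝ (Fin n) → Matrix (Fin m) (Fin m) ℝ}
    (h : ∀ i j, ContDiffOn ℝ ∞ (fun y => A y i j) U) :
    ContDiffOn ℝ ∞ (fun y => (A y).det) U := by
  simp only [Matrix.det_apply]
  exact ContDiffOn.sum fun σ _ => (contDiffOn_prod fun i _ => h _ _).const_smul _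

lemma symm (h : IsMetricOn g U) (hy : y ∈ U) (i j : Fin n) : g y i j = g y j i := by
  simpa using ((h.posDef y hy).isHermitian.apply i j).symm

lemma isUnit_det (h : IsMetricOn g U) (hy : y ∈ U) : IsUnit (g y).det :=
  (h.posDef y hy).det_pos.ne'.isUnit

/-- By Cramer's rule the entries of the inverse are quotients of polynomials in the entries of g. -/
lemma contDiffOn_inv (h : IsMetricOn g U) (i j : Fin n) :
    ContDiffOn ℝ ∞ (fun y => (g y)⁻¹ i j) U := by
  simp only [Matrix.inv_def, Matrix.smul_apply, Ring.inverse_eq_inv', smul_eq_mul,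
    Matrix.adjugate_apply]
  refine ((contDiffOn_det h.contDiffOn).inv fun y hy => (h.isUnit_det hy).ne_zero).mul ?_
  refine contDiffOn_det fun a b => ?_
  by_cases ha : a = j
  · subst ha
    simpa using contDiffOn_const
  · simpa [Matrix.updateRow_ne ha] using h.contDiffOn a b

lemma _root_.RiemannCoord.contDiffOn_partialDeriv (hU : IsOpen U)
    {f : EuclideanSpace ℝ (Fin n) → ℝ}
    (hf : ContDiffOn ℝ ∞ f U) (i : Fin n) : ContDiffOn ℝ ∞ (partialDeriv i f) U :=
  (hf.fderiv_of_isOpen hU (by simp)).clm_apply contDiffOn_const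

lemma contDiffOn_christoffel (h : IsMetricOn g U) (k i j : Fin n) :
    ContDiffOn ℝ ∞ (christoffel g k i j) U := by
  refine contDiffOn_const.mul (ContDiffOn.sum fun l _ => (h.contDiffOn_inv k l).mul ?_)
  exact ((contDiffOn_partialDeriv h.isOpen (h.contDiffOn j l) i).add
    (contDiffOn_partialDeriv h.isOpen (h.contDiffOn i l) j)).sub
    (contDiffOn_partialDeriv h.isOpen (h.contDiffOn i j) l)

lemma contDiffOn_curvature (h : IsMetricOn g U) (l i j k : Fin n) :
    ContDiffOn ℝ ∞ (curvature g l i j k) U := by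
  refine ((contDiffOn_partialDeriv h.isOpen (h.contDiffOn_christoffel l j k) i).sub
    (contDiffOn_partialDeriv h.isOpen (h.contDiffOn_christoffel l i k) j)).add
    (ContDiffOn.sum fun m _ => ?_)
  exact ((h.contDiffOn_christoffel l i m).mul (h.contDiffOn_christoffel m j k)).sub
    ((h.contDiffOn_christoffel l j m).mul (h.contDiffOn_christoffel m i k))

lemma contDiffOn_riemann (h : IsMetricOn g U) (I : Fin 4 → Fin n) :
    ContDiffOn ℝ ∞ (riemann g I) U :=
  ContDiffOn.sum fun m _ => (h.contDiffOn _ m).mul (h.contDiffOn_curvature m _ _ _)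

lemma _root_.RiemannCoord.differentiableAt_of_contDiffOn (hU : IsOpen U) {F : Type*}
    [NormedAddCommGroup F] [NormedSpace ℝ F] {f : EuclideanSpace ℝ (Fin n) → F}
    (hf : ContDiffOn ℝ ∞ f U) (hy : y ∈ U) : DifferentiableAt ℝ f y :=
  (hf.contDiffAt (hU.mem_nhds hy)).differentiableAt (by simp)

lemma differentiableAt_metricForm (h : IsMetricOn g U) (hy : y ∈ U) :
    DifferentiableAt ℝ (metricForm g) y :=
  differentiableAt_coeffForm fun i j =>
    differentiableAt_of_contDiffOn h.isOpen (h.contDiffOn i j) hy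

lemma differentiableAt_christoffelForm (h : IsMetricOn g U) (hy : y ∈ U) :
    DifferentiableAt ℝ (christoffelForm g) y := by
  refine differentiableAt_coeffForm fun i j => ?_
  rw [differentiableAt_euclidean]
  exact fun k => differentiableAt_of_contDiffOn h.isOpen (h.contDiffOn_christoffel k i j) hy

lemma metricForm_symm (h : IsMetricOn g U) (hy : y ∈ U) (u v : EuclideanSpace ℝ (Fin n)) :
    metricForm g y u v = metricForm g y v u := by
  simp only [metricForm, coeffForm_apply]
  rw [Finset.sum_comm]
  refine Finset.sum_congr rfl fun i _ => Finset.sum_congr rfl fun j _ => ?_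
  rw [h.symm hy j i, smul_comm]

lemma christoffel_symm (h : IsMetricOn g U) (hy : y ∈ U) (k i j : Fin n) :
    christoffel g k i j y = christoffel g k j i y := by
  simp only [christoffel]
  congr 1
  refine Finset.sum_congr rfl fun l _ => ?_
  have : (fun z => g z i j) =ᶠ[nhds y] fun z => g z j i := by
    filter_upwards [h.isOpen.mem_nhds hy] with z hz using h.symm hz i j
  have e : partialDeriv l (fun z => g z i j) y = partialDeriv l (fun z => g z j i) y := by
    simp only [partialDeriv, this.fderiv_eq]
  rw [e, add_comm]

lemma christoffelForm_symm (h : IsMetricOn g U) (hy : y ∈ U) (u v : EuclideanSpace ℝ (Fin n)) :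
    christoffelForm g y u v = christoffelForm g y v u := by
  simp only [christoffelForm, coeffForm_apply]
  rw [Finset.sum_comm]
  refine Finset.sum_congr rfl fun i _ => Finset.sum_congr rfl fun j _ => ?_
  simp only [h.christoffel_symm hy _ j i]
  rw [smul_comm]

lemma _root_.RiemannCoord.metricForm_eq_dotProduct (g) (u v : EuclideanSpace ℝ (Fin n)) :
    metricForm g y u v = (u : Fin n → ℝ) ⬝ᵥ (g y).mulVec v := by
  simp only [metricForm, coeffForm_apply, dotProduct, Matrix.mulVec, smul_eq_mul, Finset.mul_sum]
  refine Finset.sum_congr rfl fun i _ => Finset.sum_congr rfl fun j _ => by ring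

lemma metricForm_nondeg (h : IsMetricOn g U) (hy : y ∈ U) (u : EuclideanSpace ℝ (Fin n))
    (hu : ∀ v, metricForm g y u v = 0) : u = 0 := by
  by_contra hne
  have h1 := (h.posDef y hy).dotProduct_mulVec_pos (x := u.ofLp) (by simpa using hne)
  have h2 := hu u
  rw [metricForm_eq_dotProduct] at h2
  simp only [star_trivial] at h1
  exact h1.ne' h2

/-- The sum `∑ₗ Γˡᵢⱼ gₗₖ` is the Christoffel symbol of the first kind. -/
lemma sum_christoffel_mul (h : IsMetricOn g U) (hy : y ∈ U) (i j k : Fin n) :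
    2 * ∑ l, christoffel g l i j y * g y l k =
      partialDeriv i (fun z => g z j k) y + partialDeriv j (fun z => g z i k) y
        - partialDeriv k (fun z => g z i j) y := by
  set c : Fin n → ℝ := fun l => partialDeriv i (fun z => g z j l) y
    + partialDeriv j (fun z => g z i l) y - partialDeriv l (fun z => g z i j) y with hc
  have h1 : ∀ l, christoffel g l i j y = 1 / 2 * ((g y)⁻¹.mulVec c) l := fun l => rfl
  have h2 : (g y).mulVec ((g y)⁻¹.mulVec c) k = c k := by
    rw [Matrix.mulVec_mulVec, Matrix.mul_nonsing_inv _ (h.isUnit_det hy), Matrix.one_mulVec]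
  change _ = c k
  rw [← h2, Matrix.mulVec, dotProduct, Finset.mul_sum]
  refine Finset.sum_congr rfl fun l _ => ?_
  rw [h1, h.symm hy l k]
  ring

/-- The Koszul formula in the form required by `ConnectionChange.christoffel_change`; by linearity
in each slot it is enough to check basis vectors. -/
lemma levi_civita (h : IsMetricOn g U) (hy : y ∈ U) (u v w : EuclideanSpace ℝ (Fin n)) :
    2 * metricForm g y (christoffelForm g y u v) w =
      fderiv ℝ (metricForm g) y u v w + fderiv ℝ (metricForm g) y v u w
        - fderiv ℝ (metricForm g) y w u v := by
  revert u
  refine eq_of_isLinearMap_single ⟨by intros; simp; ring, by intros; simp; ring⟩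
    ⟨by intros; simp; ring, by intros; simp; ring⟩ fun i => ?_
  revert v
  refine eq_of_isLinearMap_single ⟨by intros; simp; ring, by intros; simp; ring⟩
    ⟨by intros; simp; ring, by intros; simp; ring⟩ fun j => ?_
  revert w
  refine eq_of_isLinearMap_single ⟨by intros; simp; ring, by intros; simp; ring⟩
    ⟨by intros; simp; ring, by intros; simp; ring⟩ fun k => ?_
  have hd := h.differentiableAt_metricForm hy
  simp only [← ConnectionChange.fderiv_apply_apply hd]
  have e : ∀ i j, (fun z => metricForm g z (EuclideanSpace.single i 1)
      (EuclideanSpace.single j 1)) = fun z => g z i j := by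
    intro i j
    ext z
    rw [metricForm, coeffForm_single]
  simp only [e]
  have h1 := h.sum_christoffel_mul hy i j k
  simp only [partialDeriv] at h1
  rw [← h1, christoffelForm, coeffForm_single, metricForm, coeffForm_apply]
  simp

/-- The components of the curvature tensor. -/
lemma riemann_eq (h : IsMetricOn g U) (hy : y ∈ U) (I : Fin 4 → Fin n) :
    riemann g I y = metricForm g y (EuclideanSpace.single (I 3) 1)
      (ConnectionChange.curv (christoffelForm g) y (EuclideanSpace.single (I 0) 1)
        (EuclideanSpace.single (I 1) 1) (EuclideanSpace.single (I 2) 1)) := by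
  have hd := h.differentiableAt_christoffelForm hy
  have e : ∀ a b c l, (fderiv ℝ (christoffelForm g) y (EuclideanSpace.single a 1)
      (EuclideanSpace.single b 1) (EuclideanSpace.single c 1)) l =
      partialDeriv a (christoffel g l b c) y := by
    intro a b c l
    rw [← ConnectionChange.fderiv_apply_apply hd]
    have e1 : (fun z => christoffelForm g z (EuclideanSpace.single b 1)
      (EuclideanSpace.single c 1)) = fun z => WithLp.toLp 2 fun k => christoffel g k b c z := by
      ext z : 1
      rw [christoffelForm, coeffForm_single]
    have hd1 : DifferentiableAt ℝ (fun z => (WithLp.toLp 2 fun k => christoffel g k b c z :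
        EuclideanSpace ℝ (Fin n))) y := by
      rw [differentiableAt_euclidean]
      exact fun k => differentiableAt_of_contDiffOn h.isOpen (h.contDiffOn_christoffel k b c) hy
    rw [e1, partialDeriv]
    have := ((EuclideanSpace.proj l : EuclideanSpace ℝ (Fin n) →L[ℝ] ℝ).hasFDerivAt.comp y
      hd1.hasFDerivAt).fderiv
    have e2 : (⇑(EuclideanSpace.proj l : EuclideanSpace ℝ (Fin n) →L[ℝ] ℝ) ∘
      fun z => (WithLp.toLp 2 fun k => christoffel g k b c z : EuclideanSpace ℝ (Fin n))) =
      christoffel g l b c := rfl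
    rw [e2] at this
    rw [this]
    rfl
  have e3 : ∀ a b c l, (christoffelForm g y (EuclideanSpace.single a 1)
      (christoffelForm g y (EuclideanSpace.single b 1) (EuclideanSpace.single c 1))) l =
      ∑ m, christoffel g l a m y * christoffel g m b c y := by
    intro a b c l
    simp only [christoffelForm]
    rw [coeffForm_single, coeffForm_apply]
    simp [mul_comm]
  rw [metricForm, coeffForm_apply]
  simp only [riemann, curvature, ConnectionChange.curv, PiLp.sub_apply, PiLp.add_apply, e,
    e3]
  simp [Finset.sum_sub_distrib, mul_comm, add_sub_assoc]

end IsMetricOn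

/-! ### Local isometries and invariance of the curvature norm -/

/-- The Jacobian matrix. -/
noncomputable def jacobian (φ : EuclideanSpace ℝ (Fin n) → EuclideanSpace ℝ (Fin n))
    (y : EuclideanSpace ℝ (Fin n)) : Matrix (Fin n) (Fin n) ℝ :=
  Matrix.of fun a i => fderiv ℝ φ y (EuclideanSpace.single i 1) a

/-- `φ` is smooth on the open set `W` and pulls back `g₂` to `g₁`. -/
structure IsIsometryOn (g₁ g₂ : EuclideanSpace ℝ (Fin n) → Matrix (Fin n) (Fin n) ℝ)
    (φ : EuclideanSpace ℝ (Fin n) → EuclideanSpace ℝ (Fin n))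
    (W : Set (EuclideanSpace ℝ (Fin n))) : Prop where
  isOpen : IsOpen W
  contDiffOn : ContDiffOn ℝ ∞ φ W
  pullback : ∀ y ∈ W, g₁ y = (jacobian φ y).transpose * g₂ (φ y) * jacobian φ y

lemma jacobian_mulVec (φ : EuclideanSpace ℝ (Fin n) → EuclideanSpace ℝ (Fin n))
    (y u : EuclideanSpace ℝ (Fin n)) :
    (jacobian φ y).mulVec u = (fderiv ℝ φ y u : EuclideanSpace ℝ (Fin n)).ofLp := by
  revert u
  refine eq_of_isLinearMap_single ⟨fun _ _ => by simp [Matrix.mulVec_add], fun _ _ => by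
    simp [Matrix.mulVec_smul]⟩ ⟨fun _ _ => by simp, fun _ _ => by simp⟩ fun i => ?_
  ext a
  simp [jacobian, Matrix.mulVec, dotProduct]

namespace IsIsometryOn

variable {g₁ g₂ : EuclideanSpace ℝ (Fin n) → Matrix (Fin n) (Fin n) ℝ}
  {φ : EuclideanSpace ℝ (Fin n) → EuclideanSpace ℝ (Fin n)}
  {W U V : Set (EuclideanSpace ℝ (Fin n))} {y : EuclideanSpace ℝ (Fin n)}

/-- The pulled back metric is nondegenerate, which forces the Jacobian to be invertible; no local
inverse has to be assumed. -/
lemma isUnit_det (h : IsIsometryOn g₁ g₂ φ W) (h₁ : IsMetricOn g₁ U) (hWU : W ⊆ U)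
    (hy : y ∈ W) : IsUnit (jacobian φ y).det := by
  have h1 := h₁.isUnit_det (hWU hy)
  rw [h.pullback y hy, Matrix.det_mul] at h1
  exact isUnit_of_mul_isUnit_right h1

lemma metricForm_eq (h : IsIsometryOn g₁ g₂ φ W) (hy : y ∈ W)
    (u v : EuclideanSpace ℝ (Fin n)) :
    metricForm g₁ y u v = metricForm g₂ (φ y) (fderiv ℝ φ y u) (fderiv ℝ φ y v) := by
  rw [metricForm_eq_dotProduct, metricForm_eq_dotProduct, h.pullback y hy, ← jacobian_mulVec,
    ← jacobian_mulVec, ← Matrix.mulVec_mulVec, ← Matrix.mulVec_mulVec, Matrix.dotProduct_mulVec,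
    Matrix.vecMul_transpose]

lemma surjective_fderiv (h : IsIsometryOn g₁ g₂ φ W) (h₁ : IsMetricOn g₁ U) (hWU : W ⊆ U)
    (hy : y ∈ W) : Function.Surjective (fderiv ℝ φ y) := by
  intro b
  refine ⟨WithLp.toLp 2 ((jacobian φ y)⁻¹.mulVec b), ?_⟩
  have := jacobian_mulVec φ y (WithLp.toLp 2 ((jacobian φ y)⁻¹.mulVec b))
  rw [Matrix.mulVec_mulVec, Matrix.mul_nonsing_inv _ (h.isUnit_det h₁ hWU hy),
    Matrix.one_mulVec] at this
  exact WithLp.ofLp_injective 2 this.symm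

lemma contDiffAt (h : IsIsometryOn g₁ g₂ φ W) (hy : y ∈ W) : ContDiffAt ℝ ∞ φ y :=
  h.contDiffOn.contDiffAt (h.isOpen.mem_nhds hy)

lemma christoffelForm_eq (h : IsIsometryOn g₁ g₂ φ W) (h₁ : IsMetricOn g₁ U) (hWU : W ⊆ U)
    (h₂ : IsMetricOn g₂ V) (hWV : Set.MapsTo φ W V) (hy : y ∈ W)
    (u v : EuclideanSpace ℝ (Fin n)) :
    fderiv ℝ φ y (christoffelForm g₁ y u v) = fderiv ℝ (fderiv ℝ φ) y u v +
      christoffelForm g₂ (φ y) (fderiv ℝ φ y u) (fderiv ℝ φ y v) := by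
  refine ConnectionChange.christoffel_change (G₁ := metricForm g₁) (G₂ := metricForm g₂)
    ((h.contDiffAt hy).of_le ENat.LEInfty.out)
    (h₁.differentiableAt_metricForm (hWU hy)) (h₂.differentiableAt_metricForm (hWV hy)) ?_
    (h₂.metricForm_symm (hWV hy)) (h₂.metricForm_nondeg (hWV hy)) (h.surjective_fderiv h₁ hWU hy)
    (h₁.levi_civita (hWU hy)) (h₂.levi_civita (hWV hy)) u v
  filter_upwards [h.isOpen.mem_nhds hy] with z hz using h.metricForm_eq hz

lemma curv_eq (h : IsIsometryOn g₁ g₂ φ W) (h₁ : IsMetricOn g₁ U) (hWU : W ⊆ U)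
    (h₂ : IsMetricOn g₂ V) (hWV : Set.MapsTo φ W V) (hy : y ∈ W)
    (u v w : EuclideanSpace ℝ (Fin n)) :
    fderiv ℝ φ y (ConnectionChange.curv (christoffelForm g₁) y u v w) =
      ConnectionChange.curv (christoffelForm g₂) (φ y) (fderiv ℝ φ y u) (fderiv ℝ φ y v)
        (fderiv ℝ φ y w) := by
  refine ConnectionChange.curv_change ((h.contDiffAt hy).of_le ENat.LEInfty.out)
    (h₁.differentiableAt_christoffelForm (hWU hy)) (h₂.differentiableAt_christoffelForm (hWV hy))
    ?_ (h₂.christoffelForm_symm (hWV hy)) u v w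
  filter_upwards [h.isOpen.mem_nhds hy] with z hz using h.christoffelForm_eq h₁ hWU h₂ hWV hz

lemma _root_.RiemannCoord.sum_multiIndex_four (f : (Fin 4 → Fin n) → ℝ) :
    ∑ K, f K = ∑ a, ∑ b, ∑ c, ∑ d, f ![a, b, c, d] := by
  have h : ∀ {k : ℕ} (f : (Fin (k + 1) → Fin n) → ℝ),
      ∑ K, f K = ∑ a, ∑ K : Fin k → Fin n, f (Matrix.vecCons a K) := by
    intro k f
    rw [← (Fin.consEquiv (fun _ => Fin n)).sum_comp, Fintype.sum_prod_type]
    rfl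
  rw [h]
  refine Finset.sum_congr rfl fun a _ => ?_
  rw [h]
  refine Finset.sum_congr rfl fun b _ => ?_
  rw [h]
  refine Finset.sum_congr rfl fun c _ => ?_
  rw [h]
  refine Finset.sum_congr rfl fun d _ => ?_
  rw [Fintype.sum_unique]
  congr

lemma riemann_eq_mulVec (h : IsIsometryOn g₁ g₂ φ W) (h₁ : IsMetricOn g₁ U) (hWU : W ⊆ U)
    (h₂ : IsMetricOn g₂ V) (hWV : Set.MapsTo φ W V) (hy : y ∈ W) :
    (fun I => riemann g₁ I y) =
      (tensorPow (jacobian φ y).transpose 4).mulVec (fun I => riemann g₂ I (φ y)) := by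
  -- The images of basis vectors are expanded in the target basis; multilinearity in the four slots
  -- then produces the tensor power of the Jacobian.
  have hexp : ∀ i, fderiv ℝ φ y (EuclideanSpace.single i 1) =
      ∑ a, jacobian φ y a i • EuclideanSpace.single a (1 : ℝ) := by
    intro i
    ext b
    simp [jacobian, Pi.single_apply]
  obtain ⟨l1, l2, l3⟩ := ConnectionChange.isLinearMap_curv (christoffelForm g₂) (φ y)
  ext I
  rw [h₁.riemann_eq (hWU hy), h.metricForm_eq hy, h.curv_eq h₁ hWU h₂ hWV hy]
  simp only [hexp]
  have e1 := fun (c : Fin n → ℝ) v w => map_sum ((l1 v w).mk' _)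
    (fun a => c a • EuclideanSpace.single a (1 : ℝ)) Finset.univ
  have e2 := fun (c : Fin n → ℝ) u w => map_sum ((l2 u w).mk' _)
    (fun a => c a • EuclideanSpace.single a (1 : ℝ)) Finset.univ
  have e3 := fun (c : Fin n → ℝ) u v => map_sum ((l3 u v).mk' _)
    (fun a => c a • EuclideanSpace.single a (1 : ℝ)) Finset.univ
  have s1 := fun (c : ℝ) u v w => (l1 v w).map_smul c u
  have s2 := fun (c : ℝ) u v w => (l2 u w).map_smul c v
  have s3 := fun (c : ℝ) u v w => (l3 u v).map_smul c w
  simp only [IsLinearMap.mk'_apply] at e1 e2 e3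
  simp only [e1, e2, e3, s1, s2, s3]
  simp only [map_sum, map_smul, sum_apply, smul_apply,
    smul_eq_mul]
  simp only [Matrix.mulVec, dotProduct, tensorPow_apply, Matrix.transpose_apply,
    h₂.riemann_eq (hWV hy)]
  rw [sum_multiIndex_four]
  simp only [Fin.prod_univ_four]
  simp
  simp only [Finset.mul_sum, mul_assoc]

/-- The norm of the curvature tensor is invariant under isometries. -/
lemma tensorNorm_riemann_eq (h : IsIsometryOn g₁ g₂ φ W) (h₁ : IsMetricOn g₁ U) (hWU : W ⊆ U)
    (h₂ : IsMetricOn g₂ V) (hWV : Set.MapsTo φ W V) (hy : y ∈ W) :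
    tensorNorm (g₁ y) (fun I => riemann g₁ I y) =
      tensorNorm (g₂ (φ y)) (fun I => riemann g₂ I (φ y)) := by
  rw [h.riemann_eq_mulVec h₁ hWU h₂ hWV hy, h.pullback y hy,
    tensorNorm_change _ _ (h.isUnit_det h₁ hWU hy)]

end IsIsometryOn

end RiemannCoord

namespace RiemannCoord

variable {n : ℕ}

/-! ### Metric compatibility -/

/-- Exchanging the entry `J a` of a multi-index with an additional index. -/
lemma sum_update_exchange {k : ℕ} (a : Fin k) (F : (Fin k → Fin n) → Fin n → ℝ) :
    ∑ J, ∑ b, F J b = ∑ J, ∑ b, F (Function.update J a b) (J a) := by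
  rw [← Fintype.sum_prod_type', ← Fintype.sum_prod_type']
  -- Swapping the entry at position a with the extra index is an involution, hence a reindexing of
  -- the double sum.
  let e : (Fin k → Fin n) × Fin n → (Fin k → Fin n) × Fin n :=
    fun p => (Function.update p.1 a p.2, p.1 a)
  have he : Function.Involutive e := fun p => by simp [e]
  exact (Equiv.sum_comp he.toPerm fun p : (Fin k → Fin n) × Fin n => F p.1 p.2).symm

namespace IsMetricOn

variable {g : EuclideanSpace ℝ (Fin n) → Matrix (Fin n) (Fin n) ℝ}
  {U : Set (EuclideanSpace ℝ (Fin n))} {y : EuclideanSpace ℝ (Fin n)}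

/-- This is ∇g = 0: adding the Koszul identities for (m, i, j) and (m, j, i) leaves only the
derivative in direction m. -/
lemma partialDeriv_metric (h : IsMetricOn g U) (hy : y ∈ U) (m i j : Fin n) :
    partialDeriv m (fun z => g z i j) y =
      ∑ l, (christoffel g l m i y * g y l j + christoffel g l m j y * g y i l) := by
  have h1 := h.sum_christoffel_mul hy m i j
  have h2 := h.sum_christoffel_mul hy m j i
  have e : ∀ a b c, partialDeriv c (fun z => g z a b) y = partialDeriv c (fun z => g z b a) y := by
    intro a b c
    have : (fun z => g z a b) =ᶠ[nhds y] fun z => g z b a := by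
      filter_upwards [h.isOpen.mem_nhds hy] with z hz using h.symm hz a b
    simp only [partialDeriv, this.fderiv_eq]
  rw [e j i m] at h2
  have e3 : ∀ l, g y i l = g y l i := fun l => h.symm hy i l
  simp only [e3, Finset.sum_add_distrib]
  linarith

/-- This is ∇g⁻¹ = 0, obtained by differentiating g⁻¹g = 1 and inserting ∇g = 0. -/
lemma partialDeriv_inv (h : IsMetricOn g U) (hy : y ∈ U) (m i j : Fin n) :
    partialDeriv m (fun z => (g z)⁻¹ i j) y =
      -∑ l, (christoffel g i m l y * (g y)⁻¹ l j + christoffel g j m l y * (g y)⁻¹ i l) := by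
  set Γ : Matrix (Fin n) (Fin n) ℝ := Matrix.of fun l i => christoffel g l m i y with hΓ
  set dG : Matrix (Fin n) (Fin n) ℝ := Matrix.of fun i j => partialDeriv m (fun z => g z i j) y
    with hdG
  set dH : Matrix (Fin n) (Fin n) ℝ := Matrix.of fun i j =>
    partialDeriv m (fun z => (g z)⁻¹ i j) y with hdH
  have hG : dG = Γ.transpose * g y + g y * Γ := by
    ext i j
    simp only [hdG, Matrix.of_apply, h.partialDeriv_metric hy, Matrix.add_apply, Matrix.mul_apply,
      hΓ, Matrix.transpose_apply, Finset.sum_add_distrib, mul_comm (g y i _)]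
  have hprod : dH * g y + (g y)⁻¹ * dG = 0 := by
    ext i j
    have hc : (fun z => ∑ l, (g z)⁻¹ i l * g z l j) =ᶠ[nhds y]
        fun _ => (1 : Matrix (Fin n) (Fin n) ℝ) i j := by
      filter_upwards [h.isOpen.mem_nhds hy] with z hz
      rw [← Matrix.mul_apply, Matrix.nonsing_inv_mul _ (h.isUnit_det hz)]
    have hd : ∀ l, DifferentiableAt ℝ (fun z => (g z)⁻¹ i l) y := fun l =>
      differentiableAt_of_contDiffOn h.isOpen (h.contDiffOn_inv i l) hy
    have hd' : ∀ l, DifferentiableAt ℝ (fun z => g z l j) y := fun l =>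
      differentiableAt_of_contDiffOn h.isOpen (h.contDiffOn l j) hy
    have h1 := (HasFDerivAt.fun_sum fun (l : Fin n) (_ : l ∈ Finset.univ) =>
      (hd l).hasFDerivAt.fun_mul (hd' l).hasFDerivAt).fderiv
    rw [hc.fderiv_eq] at h1
    have h2 := DFunLike.congr_fun h1 (EuclideanSpace.single m 1)
    simp only [fderiv_fun_const, Pi.zero_apply, zero_apply, sum_apply, add_apply, smul_apply,
      smul_eq_mul] at h2
    rw [Matrix.add_apply, Matrix.mul_apply, Matrix.mul_apply, ← Finset.sum_add_distrib,
      Matrix.zero_apply, h2]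
    refine Finset.sum_congr rfl fun l _ => ?_
    simp only [hdH, hdG, Matrix.of_apply, partialDeriv]
    ring
  have hH : dH = -(Γ * (g y)⁻¹ + (g y)⁻¹ * Γ.transpose) := by
    have e1 : dH * g y = -((g y)⁻¹ * dG) := eq_neg_of_add_eq_zero_left hprod
    calc dH = dH * g y * (g y)⁻¹ := by
          rw [Matrix.mul_assoc, Matrix.mul_nonsing_inv _ (h.isUnit_det hy), Matrix.mul_one]
      _ = -((g y)⁻¹ * Γ.transpose * (g y * (g y)⁻¹) + (g y)⁻¹ * g y * Γ * (g y)⁻¹) := by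
          rw [e1, hG]
          noncomm_ring
      _ = _ := by
          rw [Matrix.mul_nonsing_inv _ (h.isUnit_det hy), Matrix.nonsing_inv_mul _ (h.isUnit_det hy),
            Matrix.mul_one, Matrix.one_mul, add_comm]
  have := congr_fun (congr_fun hH i) j
  simp only [hdH, Matrix.of_apply, Matrix.neg_apply, Matrix.add_apply, Matrix.mul_apply, hΓ,
    Matrix.transpose_apply] at this
  rw [this, Finset.sum_add_distrib]
  simp only [mul_comm ((g y)⁻¹ i _)]

lemma inv_symm (h : IsMetricOn g U) (hy : y ∈ U) (i j : Fin n) :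
    (g y)⁻¹ i j = (g y)⁻¹ j i := by
  simpa using ((h.posDef y hy).inv.isHermitian.apply i j).symm

/-- The part of the derivative of |T|² in which the factor of g⁻¹ at position a is differentiated.
It supplies the Christoffel correction that turns ∂T into ∇T in that slot; the factor 2 comes from
the symmetry between I and J. -/
lemma sum_prod_erase_mul_partialDeriv_inv (h : IsMetricOn g U) (hy : y ∈ U) {k : ℕ} (m : Fin n)
    (a : Fin k) (T : (Fin k → Fin n) → ℝ) :
    ∑ I, ∑ J, (∏ c ∈ Finset.univ.erase a, (g y)⁻¹ (I c) (J c)) *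
        partialDeriv m (fun z => (g z)⁻¹ (I a) (J a)) y * T I * T J =
      -2 * ∑ I, ∑ J, (∏ c, (g y)⁻¹ (I c) (J c)) * T I *
        ∑ b, christoffel g b m (J a) y * T (Function.update J a b) := by
  set P : (Fin k → Fin n) → (Fin k → Fin n) → ℝ :=
    fun I J => ∏ c ∈ Finset.univ.erase a, (g y)⁻¹ (I c) (J c) with hP
  have hPs : ∀ I J, P I J = P J I := fun I J =>
    Finset.prod_congr rfl fun c _ => h.inv_symm hy _ _
  have hPu : ∀ I J b, P I (Function.update J a b) = P I J := fun I J b =>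
    Finset.prod_congr rfl fun c hc => by
      rw [Function.update_of_ne (Finset.ne_of_mem_erase hc)]
  have hone : ∀ I J : Fin k → Fin n, P I J * (g y)⁻¹ (I a) (J a) = ∏ c, (g y)⁻¹ (I c) (J c) :=
    fun I J => Finset.prod_erase_mul _ _ (Finset.mem_univ a)
  have hB : ∑ I, ∑ J, P I J * (∑ l, christoffel g (J a) m l y * (g y)⁻¹ (I a) l) * T I * T J =
      ∑ I, ∑ J, (∏ c, (g y)⁻¹ (I c) (J c)) * T I *
        ∑ b, christoffel g b m (J a) y * T (Function.update J a b) := by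
    refine Finset.sum_congr rfl fun I _ => ?_
    simp only [Finset.mul_sum, Finset.sum_mul]
    rw [sum_update_exchange a]
    refine Finset.sum_congr rfl fun J _ => Finset.sum_congr rfl fun b _ => ?_
    rw [hPu, Function.update_self, ← hone]
    ring
  have hA : ∑ I, ∑ J, P I J * (∑ l, christoffel g (I a) m l y * (g y)⁻¹ l (J a)) * T I * T J =
      ∑ I, ∑ J, P I J * (∑ l, christoffel g (J a) m l y * (g y)⁻¹ (I a) l) * T I * T J := by
    rw [Finset.sum_comm]
    refine Finset.sum_congr rfl fun I _ => Finset.sum_congr rfl fun J _ => ?_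
    rw [hPs J I]
    simp only [h.inv_symm hy _ (I a)]
    ring
  rw [← hB, neg_mul, two_mul]
  nth_rewrite 1 [← hA]
  rw [← Finset.sum_add_distrib, ← Finset.sum_neg_distrib]
  refine Finset.sum_congr rfl fun I _ => ?_
  rw [← Finset.sum_add_distrib, ← Finset.sum_neg_distrib]
  refine Finset.sum_congr rfl fun J _ => ?_
  rw [h.partialDeriv_inv hy, Finset.sum_add_distrib]
  ring

/-- The derivative of `|T|²` is `2 ⟨T, ∇T⟩`. -/
lemma hasFDerivAt_norm_sq (h : IsMetricOn g U) (hy : y ∈ U) {k : ℕ}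
    {T : (Fin k → Fin n) → EuclideanSpace ℝ (Fin n) → ℝ}
    (hT : ∀ I, DifferentiableAt ℝ (T I) y) :
    ∃ N' : EuclideanSpace ℝ (Fin n) →L[ℝ] ℝ,
      HasFDerivAt (fun z => tensorNorm (g z) (fun I => T I z) ^ 2) N' y ∧
      ∀ v : EuclideanSpace ℝ (Fin n), N' v = 2 * ((fun I => T I y) ⬝ᵥ
        (tensorPow (g y)⁻¹ k).mulVec fun I => ∑ m, v m * nabla g T (Fin.cons m I) y) := by
  have hev : (fun z => tensorNorm (g z) (fun I => T I z) ^ 2) =ᶠ[nhds y]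
      fun z => ∑ I, ∑ J, (∏ a, (g z)⁻¹ (I a) (J a)) * T I z * T J z := by
    filter_upwards [h.isOpen.mem_nhds hy] with z hz
    rw [tensorNorm_sq (h.posDef z hz)]
    simp only [dotProduct, Matrix.mulVec, Finset.mul_sum, tensorPow_apply]
    exact Finset.sum_congr rfl fun I _ => Finset.sum_congr rfl fun J _ => by ring
  have hd : ∀ i j, DifferentiableAt ℝ (fun z => (g z)⁻¹ i j) y := fun i j =>
    differentiableAt_of_contDiffOn h.isOpen (h.contDiffOn_inv i j) hy
  have hp : ∀ I J : Fin k → Fin n, HasFDerivAt (fun z => ∏ a, (g z)⁻¹ (I a) (J a))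
      (∑ a, (∏ c ∈ Finset.univ.erase a, (g y)⁻¹ (I c) (J c)) •
        fderiv ℝ (fun z => (g z)⁻¹ (I a) (J a)) y) y := fun I J =>
    HasFDerivAt.finsetProd fun a _ => (hd (I a) (J a)).hasFDerivAt
  have hN := HasFDerivAt.fun_sum fun (I : Fin k → Fin n) (_ : I ∈ Finset.univ) =>
    HasFDerivAt.fun_sum fun (J : Fin k → Fin n) (_ : J ∈ Finset.univ) =>
      ((hp I J).fun_mul (hT I).hasFDerivAt).fun_mul (hT J).hasFDerivAt
  refine ⟨_, hN.congr_of_eventuallyEq hev, ?_⟩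
  refine eq_of_isLinearMap_single ⟨fun _ _ => map_add _ _ _, fun _ _ => map_smul _ _ _⟩
    ⟨fun u v => ?_, fun c v => ?_⟩ fun m => ?_
  · simp only [PiLp.add_apply, add_mul, Finset.sum_add_distrib, ← mul_add, ← dotProduct_add,
      ← Matrix.mulVec_add]
    rfl
  · simp only [PiLp.smul_apply, smul_eq_mul, mul_assoc, ← Finset.mul_sum]
    rw [show (fun I : Fin k → Fin n => c * ∑ m, v m * nabla g T (Fin.cons m I) y) =
      c • fun I : Fin k → Fin n => ∑ m, v m * nabla g T (Fin.cons m I) y from rfl,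
      Matrix.mulVec_smul, dotProduct_smul, smul_eq_mul]
    ring
  · simp only [sum_apply, add_apply, smul_apply, smul_eq_mul, PiLp.single_apply, ite_mul, one_mul,
      zero_mul, Finset.sum_ite_eq', Finset.mem_univ, if_true]
    set P : (Fin k → Fin n) → (Fin k → Fin n) → ℝ := fun I J => ∏ c, (g y)⁻¹ (I c) (J c) with hP
    set D : (Fin k → Fin n) → ℝ := fun I => partialDeriv m (T I) y with hD
    set Q : Fin k → (Fin k → Fin n) → ℝ := fun a J =>
      ∑ b, christoffel g b m (J a) y * T (Function.update J a b) y with hQ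
    have hPs : ∀ I J, P I J = P J I := fun I J =>
      Finset.prod_congr rfl fun c _ => h.inv_symm hy _ _
    have hsymm : ∑ I, ∑ J, T J y * (P I J * D I) = ∑ I, ∑ J, P I J * T I y * D J := by
      rw [Finset.sum_comm]
      refine Finset.sum_congr rfl fun I _ => Finset.sum_congr rfl fun J _ => ?_
      rw [hPs J I]
      ring
    have hs : ∑ I, ∑ J, T J y * (T I y * ∑ a, (∏ c ∈ Finset.univ.erase a, (g y)⁻¹ (I c) (J c)) *
        partialDeriv m (fun z => (g z)⁻¹ (I a) (J a)) y) =
        -2 * ∑ I, ∑ J, P I J * T I y * ∑ a, Q a J := by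
      have hcomm : ∀ F : Fin k → (Fin k → Fin n) → (Fin k → Fin n) → ℝ,
          ∑ I, ∑ J, ∑ a, F a I J = ∑ a, ∑ I, ∑ J, F a I J := by
        intro F
        symm
        rw [Finset.sum_comm]
        exact Finset.sum_congr rfl fun I _ => Finset.sum_comm
      have h1 := fun a => h.sum_prod_erase_mul_partialDeriv_inv hy m a (fun I => T I y)
      simp only [Finset.mul_sum _ _ (T _ y), Finset.mul_sum _ _ (P _ _ * _)]
      rw [hcomm, hcomm, Finset.mul_sum]
      refine Finset.sum_congr rfl fun a _ => ?_
      rw [← h1 a]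
      exact Finset.sum_congr rfl fun I _ => Finset.sum_congr rfl fun J _ => by ring
    have hR : ((fun I => T I y) ⬝ᵥ (tensorPow (g y)⁻¹ k).mulVec fun I =>
        nabla g T (Fin.cons m I) y) =
        ∑ I, ∑ J, P I J * T I y * D J - ∑ I, ∑ J, P I J * T I y * ∑ a, Q a J := by
      rw [← Finset.sum_sub_distrib]
      simp only [dotProduct, Matrix.mulVec, tensorPow_apply]
      refine Finset.sum_congr rfl fun I _ => ?_
      rw [← Finset.sum_sub_distrib, Finset.mul_sum]
      refine Finset.sum_congr rfl fun J _ => ?_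
      simp only [nabla, Fin.cons_zero, Fin.tail_cons, hP, hD, hQ]
      ring
    rw [hR]
    simp only [mul_add, Finset.sum_add_distrib]
    calc _ = ∑ I, ∑ J, P I J * T I y * D J + (∑ I, ∑ J, P I J * T I y * D J +
          -2 * ∑ I, ∑ J, P I J * T I y * ∑ a, Q a J) :=
        congrArg₂ (· + ·) rfl (congrArg₂ (· + ·) hsymm hs)
      _ = _ := by ring

/-- The derivative of `|T|²` in the direction of `v` is at most `2 |T| |∇T| |v|`. -/
lemma exists_hasFDerivAt_norm_sq_le (h : IsMetricOn g U) (hy : y ∈ U) {k : ℕ}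
    {T : (Fin k → Fin n) → EuclideanSpace ℝ (Fin n) → ℝ}
    (hT : ∀ I, DifferentiableAt ℝ (T I) y) :
    ∃ N' : EuclideanSpace ℝ (Fin n) →L[ℝ] ℝ,
      HasFDerivAt (fun z => tensorNorm (g z) (fun I => T I z) ^ 2) N' y ∧
      ∀ v : EuclideanSpace ℝ (Fin n), |N' v| ≤ 2 * (tensorNorm (g y) (fun I => T I y) *
        (tensorNorm (g y) (fun J => nabla g T J y) * √(metricForm g y v v))) := by
  obtain ⟨N', hN, hN'⟩ := h.hasFDerivAt_norm_sq hy hT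
  refine ⟨N', hN, fun v => ?_⟩
  rw [hN', abs_mul, abs_of_pos (by norm_num : (0 : ℝ) < 2), metricForm_eq_dotProduct]
  exact mul_le_mul_of_nonneg_left (abs_dotProduct_contract_le (h.posDef y hy)
    (fun I => T I y) (fun J => nabla g T J y) v.ofLp) (by norm_num)

end IsMetricOn

end RiemannCoord

namespace RiemannManifold

open RiemannCoord Topology Filter

section

variable {n : ℕ} {M : Type*} [TopologicalSpace M] [ChartedSpace (EuclideanSpace ℝ (Fin n)) M]
  [RiemannianBundle (fun x : M => TangentSpace (𝓡 n) x)]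

/-! ### The metric in the charts -/

/-- The scalar product of the tangent space at `p`, on the model space. -/
noncomputable def fiberInner (p : M) (u v : EuclideanSpace ℝ (Fin n)) : ℝ :=
  @inner ℝ (TangentSpace (𝓡 n) p) _ u v

/-- The derivative of the inverse of a chart, on the model space. -/
noncomputable def symmDeriv (c : M) (y : EuclideanSpace ℝ (Fin n)) :
    EuclideanSpace ℝ (Fin n) →L[ℝ] EuclideanSpace ℝ (Fin n) :=
  mfderiv (𝓡 n) (𝓡 n) (extChartAt (𝓡 n) c).symm y

lemma chartMetric_apply (c : M) (y : EuclideanSpace ℝ (Fin n)) (i j : Fin n) :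
    chartMetric c y i j = fiberInner ((extChartAt (𝓡 n) c).symm y)
      (symmDeriv c y (EuclideanSpace.single i 1)) (symmDeriv c y (EuclideanSpace.single j 1)) :=
  rfl

lemma fiberInner_comm (p : M) (u v : EuclideanSpace ℝ (Fin n)) :
    fiberInner p u v = fiberInner p v u :=
  (real_inner_comm (F := TangentSpace (𝓡 n) p) _ _)

lemma isLinearMap_fiberInner (p : M) (v : EuclideanSpace ℝ (Fin n)) :
    IsLinearMap ℝ fun u => fiberInner p u v :=
  ⟨fun a b => inner_add_left (E := TangentSpace (𝓡 n) p) a b v,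
    fun r a => real_inner_smul_left (F := TangentSpace (𝓡 n) p) a v r⟩

lemma isLinearMap_fiberInner_right (p : M) (u : EuclideanSpace ℝ (Fin n)) :
    IsLinearMap ℝ fun v => fiberInner p u v := by
  simp only [fun v => fiberInner_comm p u v]
  exact isLinearMap_fiberInner p u

lemma fiberInner_self_pos (p : M) {u : EuclideanSpace ℝ (Fin n)} (hu : u ≠ 0) :
    0 < fiberInner p u u :=
  real_inner_self_pos (F := TangentSpace (𝓡 n) p).2 hu

lemma fiberInner_symmDeriv (c : M) (y u v : EuclideanSpace ℝ (Fin n)) :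
    fiberInner ((extChartAt (𝓡 n) c).symm y) (symmDeriv c y u) (symmDeriv c y v) =
      metricForm (chartMetric c) y u v := by
  have l1 := isLinearMap_fiberInner (n := n) ((extChartAt (𝓡 n) c).symm y)
  have l2 := isLinearMap_fiberInner_right (n := n) ((extChartAt (𝓡 n) c).symm y)
  revert u
  refine eq_of_isLinearMap_single ⟨fun a b => ?_, fun r a => ?_⟩ ⟨fun a b => ?_, fun r a => ?_⟩
    fun i => ?_
  · rw [map_add, (l1 _).map_add]
  · rw [map_smul, (l1 _).map_smul]
  · rw [map_add, add_apply]
  · rw [map_smul, smul_apply]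
  revert v
  refine eq_of_isLinearMap_single ⟨fun a b => ?_, fun r a => ?_⟩ ⟨fun a b => ?_, fun r a => ?_⟩
    fun j => ?_
  · rw [map_add, (l2 _).map_add]
  · rw [map_smul, (l2 _).map_smul]
  · rw [map_add]
  · rw [map_smul]
  rw [metricForm, coeffForm_single, chartMetric_apply]

section

variable [IsManifold (𝓡 n) ∞ M]

lemma mdifferentiableAt_symm (c : M) {y : EuclideanSpace ℝ (Fin n)}
    (hy : y ∈ (extChartAt (𝓡 n) c).target) :
    MDifferentiableAt (𝓡 n) (𝓡 n) (extChartAt (𝓡 n) c).symm y := by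
  have h := mdifferentiableWithinAt_extChartAt_symm (I := 𝓡 n) hy
  rwa [ModelWithCorners.range_eq_univ, mdifferentiableWithinAt_univ] at h

lemma isInvertible_symmDeriv (c : M) {y : EuclideanSpace ℝ (Fin n)}
    (hy : y ∈ (extChartAt (𝓡 n) c).target) : (symmDeriv c y).IsInvertible := by
  have h := isInvertible_mfderivWithin_extChartAt_symm (I := 𝓡 n) hy
  rwa [ModelWithCorners.range_eq_univ, mfderivWithin_univ] at h

lemma posDef_chartMetric (c : M) {y : EuclideanSpace ℝ (Fin n)}
    (hy : y ∈ (extChartAt (𝓡 n) c).target) : (chartMetric c y).PosDef := by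
  refine Matrix.PosDef.of_dotProduct_mulVec_pos ?_ fun v hv => ?_
  · ext i j
    simp only [Matrix.conjTranspose_apply, star_trivial, chartMetric_apply]
    exact fiberInner_comm _ _ _
  · have h1 := metricForm_eq_dotProduct (chartMetric c) (y := y) (WithLp.toLp 2 v) (WithLp.toLp 2 v)
    rw [star_trivial]
    rw [← fiberInner_symmDeriv] at h1
    refine lt_of_lt_of_eq (fiberInner_self_pos _ ?_) h1
    intro h0
    have h2 := (isInvertible_symmDeriv c hy).injective (h0.trans (map_zero _).symm)
    exact hv (by simpa using h2)

/-- The coordinate fields are smooth, being images of constant fields under the tangent map of the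
inverse chart, and the inner product of smooth sections is smooth. -/
lemma contDiffOn_chartMetric
    [IsContMDiffRiemannianBundle (𝓡 n) ∞ (EuclideanSpace ℝ (Fin n))
      (fun x : M => TangentSpace (𝓡 n) x)] (c : M) (i j : Fin n) :
    ContDiffOn ℝ ∞ (fun y => chartMetric c y i j) (extChartAt (𝓡 n) c).target := by
  have hopen := isOpen_extChartAt_target (I := 𝓡 n) c
  have hs : ∀ i : Fin n, ContMDiffOn (𝓡 n) (𝓡 n).tangent ∞
      (fun y => (⟨(extChartAt (𝓡 n) c).symm y, coordVector c i y⟩ : TangentBundle (𝓡 n) M))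
      (extChartAt (𝓡 n) c).target := by
    intro i
    have h1 := (contMDiffOn_extChartAt_symm (I := 𝓡 n) (n := ∞) c).contMDiffOn_tangentMapWithin
      (m := ∞) (by simp) hopen.uniqueMDiffOn
    have h2 : ContMDiffOn (𝓡 n) (𝓡 n).tangent ∞
        (fun y => (⟨y, EuclideanSpace.single i 1⟩ :
          TangentBundle (𝓡 n) (EuclideanSpace ℝ (Fin n))))
        (extChartAt (𝓡 n) c).target :=
      contMDiffOn_vectorSpace_iff_contDiffOn.2 contDiffOn_const
    refine (h1.comp h2 fun y hy => hy).congr fun y hy => ?_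
    simp only [Function.comp_apply, tangentMapWithin, coordVector]
    rw [mfderivWithin_of_mem_nhds (hopen.mem_nhds hy)]
  rw [← contMDiffOn_iff_contDiffOn]
  exact (hs i).inner_bundle (hs j)

variable [IsContMDiffRiemannianBundle (𝓡 n) ∞ (EuclideanSpace ℝ (Fin n))
      (fun x : M => TangentSpace (𝓡 n) x)]

lemma isMetricOn_chartMetric (c : M) :
    IsMetricOn (chartMetric (n := n) c) (extChartAt (𝓡 n) c).target :=
  ⟨isOpen_extChartAt_target c, contDiffOn_chartMetric c, fun _ hy => posDef_chartMetric c hy⟩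

/-! ### Transition maps are isometries -/

/-- The domain of the change of coordinates from the chart at `c` to the chart at `d`. -/
def transitionDomain (c d : M) : Set (EuclideanSpace ℝ (Fin n)) :=
  (extChartAt (𝓡 n) c).target ∩ (extChartAt (𝓡 n) c).symm ⁻¹' (extChartAt (𝓡 n) d).source

/-- The change of coordinates from the chart at `c` to the chart at `d`. -/
noncomputable def transition (c d : M) (y : EuclideanSpace ℝ (Fin n)) :
    EuclideanSpace ℝ (Fin n) :=
  extChartAt (𝓡 n) d ((extChartAt (𝓡 n) c).symm y)

lemma isOpen_transitionDomain (c d : M) : IsOpen (transitionDomain (n := n) c d) :=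
  (continuousOn_extChartAt_symm c).isOpen_inter_preimage (isOpen_extChartAt_target c)
    (isOpen_extChartAt_source d)

lemma contMDiffOn_transition (c d : M) :
    ContMDiffOn (𝓡 n) (𝓡 n) ∞ (transition (n := n) c d) (transitionDomain c d) := by
  have h1 := contMDiffOn_extChartAt (I := 𝓡 n) (n := ∞) (x := d)
  rw [← extChartAt_source (𝓡 n)] at h1
  exact h1.comp ((contMDiffOn_extChartAt_symm (I := 𝓡 n) (n := ∞) c).mono Set.inter_subset_left)
    fun y hy => hy.2

lemma mapsTo_transition (c d : M) :
    Set.MapsTo (transition (n := n) c d) (transitionDomain c d) (extChartAt (𝓡 n) d).target :=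
  fun _ hy => (extChartAt (𝓡 n) d).map_source hy.2

lemma symm_transition {c d : M} {y : EuclideanSpace ℝ (Fin n)}
    (hy : y ∈ transitionDomain c d) :
    (extChartAt (𝓡 n) d).symm (transition c d y) = (extChartAt (𝓡 n) c).symm y :=
  (extChartAt (𝓡 n) d).left_inv hy.2

lemma symmDeriv_eq_comp {c d : M} {y : EuclideanSpace ℝ (Fin n)}
    (hy : y ∈ transitionDomain c d) :
    symmDeriv c y = (symmDeriv d (transition c d y)).comp (fderiv ℝ (transition c d) y) := by
  have hnhds := (isOpen_transitionDomain c d).mem_nhds hy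
  have hev : (extChartAt (𝓡 n) c).symm =ᶠ[𝓝 y] (extChartAt (𝓡 n) d).symm ∘ transition c d := by
    filter_upwards [hnhds] with z hz using (symm_transition hz).symm
  have h1 := mdifferentiableAt_symm d (mapsTo_transition c d hy)
  have h2 : MDifferentiableAt (𝓡 n) (𝓡 n) (transition (n := n) c d) y :=
    ((contMDiffOn_transition c d).contMDiffAt hnhds).mdifferentiableAt (by simp)
  have h3 := mfderiv_comp y h1 h2
  have h4 := hev.mfderiv_eq (I := 𝓡 n) (I' := 𝓡 n)
  rw [← mfderiv_eq_fderiv]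
  exact h4.trans h3

/-- Both chart metrics are pulled back from the same inner product on the tangent space, so the
chain rule for the inverse charts gives the claim. -/
lemma isIsometryOn_transition (c d : M) :
    IsIsometryOn (chartMetric (n := n) c) (chartMetric d) (transition c d)
      (transitionDomain c d) where
  isOpen := isOpen_transitionDomain c d
  contDiffOn := contMDiffOn_iff_contDiffOn.1 (contMDiffOn_transition c d)
  pullback y hy := by
    have h : ∀ u v : EuclideanSpace ℝ (Fin n), metricForm (chartMetric c) y u v =
        metricForm (chartMetric d) (transition c d y) (fderiv ℝ (transition c d) y u)
          (fderiv ℝ (transition c d) y v) := by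
      intro u v
      rw [← fiberInner_symmDeriv, ← fiberInner_symmDeriv, symm_transition hy,
        symmDeriv_eq_comp hy]
      rfl
    ext i j
    have h1 := h (EuclideanSpace.single i 1) (EuclideanSpace.single j 1)
    rw [metricForm_eq_dotProduct (chartMetric d), ← jacobian_mulVec, ← jacobian_mulVec,
      ← Matrix.vecMul_transpose, ← Matrix.dotProduct_mulVec, Matrix.mulVec_mulVec,
      Matrix.mulVec_mulVec, metricForm, coeffForm_single] at h1
    rw [h1]
    simp [Matrix.mulVec, dotProduct]

/-! ### The norm of the curvature tensor -/

lemma rmNorm_eq (x : M) : rmNorm (n := n) x =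
    tensorNorm (chartMetric x (extChartAt (𝓡 n) x x))
      (fun I => riemann (chartMetric x) I (extChartAt (𝓡 n) x x)) := rfl

/-- The norm of the curvature tensor may be computed in any chart. -/
lemma rmNorm_eq_of_mem_source (c : M) {x : M} (hx : x ∈ (extChartAt (𝓡 n) c).source) :
    rmNorm (n := n) x = tensorNorm (chartMetric c (extChartAt (𝓡 n) c x))
      (fun I => riemann (chartMetric c) I (extChartAt (𝓡 n) c x)) := by
  have hmem : extChartAt (𝓡 n) x x ∈ transitionDomain (n := n) x c := by
    refine ⟨mem_extChartAt_target x, ?_⟩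
    rw [Set.mem_preimage, extChartAt_to_inv]
    exact hx
  have ht : transition x c (extChartAt (𝓡 n) x x) = extChartAt (𝓡 n) c x := by
    rw [transition, extChartAt_to_inv]
  have h := (isIsometryOn_transition x c).tensorNorm_riemann_eq (isMetricOn_chartMetric x)
    Set.inter_subset_left (isMetricOn_chartMetric c) (mapsTo_transition x c) hmem
  rw [rmNorm_eq, h, ht]

lemma rmNorm_nonneg (x : M) : 0 ≤ rmNorm (n := n) x := tensorNorm_nonneg _ _

/-- Near `c`, the squared norm of the curvature tensor has the derivative of a smooth function in
the chart, and this derivative is bounded by `2 |Rm| |∇Rm|`. -/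
lemma exists_hasFDerivAt_rmNorm_sq (c : M) :
    ∃ (N : EuclideanSpace ℝ (Fin n) → ℝ) (N' : EuclideanSpace ℝ (Fin n) →L[ℝ] ℝ),
      (∀ x ∈ (extChartAt (𝓡 n) c).source, rmNorm (n := n) x ^ 2 = N (extChartAt (𝓡 n) c x)) ∧
      HasFDerivAt N N' (extChartAt (𝓡 n) c c) ∧
      ∀ v, |N' v| ≤ 2 * (rmNorm (n := n) c * (nablaRmNorm (n := n) 1 c *
        √(metricForm (chartMetric c) (extChartAt (𝓡 n) c c) v v))) := by
  have hm := isMetricOn_chartMetric (n := n) c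
  have hc : extChartAt (𝓡 n) c c ∈ (extChartAt (𝓡 n) c).target := mem_extChartAt_target c
  obtain ⟨N', h1, h2⟩ := hm.exists_hasFDerivAt_norm_sq_le hc (T := riemann (chartMetric c))
    fun I => differentiableAt_of_contDiffOn hm.isOpen (hm.contDiffOn_riemann I) hc
  refine ⟨_, N', fun x hx => ?_, h1, h2⟩
  rw [rmNorm_eq_of_mem_source c hx]

/-- The defining chart moves with the point; near c, chart independence permits computing in the
single chart at c, and the square root restores |Rm| from its square. -/
lemma continuous_rmNorm : Continuous (rmNorm (n := n) : M → ℝ) := by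
  rw [continuous_iff_continuousAt]
  intro c
  obtain ⟨N, N', h1, h2, -⟩ := exists_hasFDerivAt_rmNorm_sq (n := n) c
  have h3 : ContinuousAt (fun x : M => √(N (extChartAt (𝓡 n) c x))) c :=
    Real.continuous_sqrt.continuousAt.comp
      (ContinuousAt.comp (f := extChartAt (𝓡 n) c) h2.continuousAt (continuousAt_extChartAt c))
  refine h3.congr ?_
  filter_upwards [extChartAt_source_mem_nhds (I := 𝓡 n) c] with x hx
  rw [← h1 x hx, Real.sqrt_sq (rmNorm_nonneg x)]

/-! ### Differentiation along curves -/

lemma norm_mfderiv_curve {γ : ℝ → M} {t : ℝ} (hγ : MDifferentiableAt 𝓘(ℝ, ℝ) (𝓡 n) γ t) :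
    ∃ v : EuclideanSpace ℝ (Fin n),
      HasDerivAt (fun s => extChartAt (𝓡 n) (γ t) (γ s)) v t ∧
      ‖mfderiv 𝓘(ℝ, ℝ) (𝓡 n) γ t 1‖ =
        √(metricForm (chartMetric (γ t)) (extChartAt (𝓡 n) (γ t) (γ t)) v v) := by
  have h1 : MDifferentiableAt (𝓡 n) (𝓡 n) (extChartAt (𝓡 n) (γ t)) (γ t) :=
    mdifferentiableAt_extChartAt (mem_chart_source _ _)
  have h2 : MDifferentiableAt 𝓘(ℝ, ℝ) (𝓡 n) (fun s => extChartAt (𝓡 n) (γ t) (γ s)) t :=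
    h1.comp t hγ
  set u : ℝ → EuclideanSpace ℝ (Fin n) := fun s => extChartAt (𝓡 n) (γ t) (γ s) with hu
  have h3 : DifferentiableAt ℝ u t := mdifferentiableAt_iff_differentiableAt.1 h2
  refine ⟨deriv u t, h3.hasDerivAt, ?_⟩
  have hev : γ =ᶠ[𝓝 t] (extChartAt (𝓡 n) (γ t)).symm ∘ u := by
    filter_upwards [hγ.continuousAt.preimage_mem_nhds
      (extChartAt_source_mem_nhds (I := 𝓡 n) (γ t))] with s hs
    exact ((extChartAt (𝓡 n) (γ t)).left_inv hs).symm
  have h4 : MDifferentiableAt (𝓡 n) (𝓡 n) (extChartAt (𝓡 n) (γ t)).symm (u t) :=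
    mdifferentiableAt_symm (γ t) (mem_extChartAt_target (γ t))
  have h5 := (hev.mfderiv_eq (I := 𝓘(ℝ, ℝ)) (I' := 𝓡 n)).trans (mfderiv_comp t h4 h2)
  have h6 : (mfderiv 𝓘(ℝ, ℝ) (𝓡 n) γ t : ℝ →L[ℝ] EuclideanSpace ℝ (Fin n)) 1 =
      symmDeriv (γ t) (u t) (deriv u t) := by
    have h7 := DFunLike.congr_fun h5 (1 : ℝ)
    rw [← fderiv_apply_one_eq_deriv, ← mfderiv_eq_fderiv]
    exact h7
  rw [← fiberInner_symmDeriv, extChartAt_to_inv, ← h6, norm_eq_sqrt_real_inner]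
  rfl

/-- The derivative at time t is taken in the chart at γ t, the very chart that defines |∇Rm| at that
point. -/
lemma exists_hasDerivAt_rmNorm_sq {γ : ℝ → M} {t : ℝ}
    (hγ : MDifferentiableAt 𝓘(ℝ, ℝ) (𝓡 n) γ t) :
    ∃ d : ℝ, HasDerivAt (fun s => rmNorm (n := n) (γ s) ^ 2) d t ∧
      |d| ≤ 2 * (rmNorm (n := n) (γ t) * (nablaRmNorm (n := n) 1 (γ t) *
        ‖mfderiv 𝓘(ℝ, ℝ) (𝓡 n) γ t 1‖)) := by
  obtain ⟨N, N', h1, h2, h3⟩ := exists_hasFDerivAt_rmNorm_sq (n := n) (γ t)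
  obtain ⟨v, hv, hn⟩ := norm_mfderiv_curve hγ
  refine ⟨N' v, ?_, ?_⟩
  · refine (HasFDerivAt.comp_hasDerivAt t h2 hv).congr_of_eventuallyEq ?_
    filter_upwards [hγ.continuousAt.preimage_mem_nhds
      (extChartAt_source_mem_nhds (I := 𝓡 n) (γ t))] with s hs
    exact h1 _ hs
  · rw [hn]
    exact h3 v

end

end

end RiemannManifold

/-! ### Change of the volume density under isometries -/

namespace RiemannCoord

variable {n : ℕ}

lemma det_fderiv_eq_det_jacobian (φ : EuclideanSpace ℝ (Fin n) → EuclideanSpace ℝ (Fin n))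
    (y : EuclideanSpace ℝ (Fin n)) : (fderiv ℝ φ y).det = (jacobian φ y).det := by
  have h : LinearMap.toMatrix (EuclideanSpace.basisFun (Fin n) ℝ).toBasis
      (EuclideanSpace.basisFun (Fin n) ℝ).toBasis
      (fderiv ℝ φ y : EuclideanSpace ℝ (Fin n) →ₗ[ℝ] EuclideanSpace ℝ (Fin n)) =
      jacobian φ y := by
    ext a i
    simp [LinearMap.toMatrix_apply, jacobian]
  rw [← h, LinearMap.det_toMatrix]

lemma IsIsometryOn.sqrt_det {g₁ g₂ : EuclideanSpace ℝ (Fin n) → Matrix (Fin n) (Fin n) ℝ}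
    {φ : EuclideanSpace ℝ (Fin n) → EuclideanSpace ℝ (Fin n)}
    {W : Set (EuclideanSpace ℝ (Fin n))} {y : EuclideanSpace ℝ (Fin n)}
    (h : IsIsometryOn g₁ g₂ φ W) (hy : y ∈ W) :
    √(g₁ y).det = |(fderiv ℝ φ y).det| * √(g₂ (φ y)).det := by
  rw [h.pullback y hy, Matrix.det_mul, Matrix.det_mul, Matrix.det_transpose,
    det_fderiv_eq_det_jacobian, ← Real.sqrt_sq_eq_abs, ← Real.sqrt_mul (sq_nonneg _)]
  congr 1
  ring

end RiemannCoord

namespace RiemannManifold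

open RiemannCoord Topology Filter

variable {n : ℕ} {M : Type*} [TopologicalSpace M] [ChartedSpace (EuclideanSpace ℝ (Fin n)) M]
  [RiemannianBundle (fun x : M => TangentSpace (𝓡 n) x)] [IsManifold (𝓡 n) ∞ M]
  [IsContMDiffRiemannianBundle (𝓡 n) ∞ (EuclideanSpace ℝ (Fin n))
      (fun x : M => TangentSpace (𝓡 n) x)]
  [MeasurableSpace M] [BorelSpace M]

/-! ### The Riemannian volume -/

/-- The coordinates of the points of `A` in the chart at `c`. -/
def chartImage (c : M) (A : Set M) : Set (EuclideanSpace ℝ (Fin n)) :=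
  (extChartAt (𝓡 n) c).symm ⁻¹' A ∩ (extChartAt (𝓡 n) c).target

lemma measurableSet_chartImage (c : M) {A : Set M} (hA : MeasurableSet A) :
    MeasurableSet (chartImage (n := n) c A) := by
  have h1 := (continuousOn_extChartAt_symm (I := 𝓡 n) c).domRestrict.measurable hA
  have h2 := (isOpen_extChartAt_target (I := 𝓡 n) c).measurableSet.subtype_image h1
  convert h2 using 1
  ext y
  simp [chartImage, and_comm]

lemma isOpen_chartImage (c : M) {A : Set M} (hA : IsOpen A) :
    IsOpen (chartImage (n := n) c A) := by
  rw [chartImage, Set.inter_comm]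
  exact (continuousOn_extChartAt_symm c).isOpen_inter_preimage (isOpen_extChartAt_target c) hA

lemma chartVolume_apply (c : M) {A : Set M} (hA : MeasurableSet A) :
    chartVolume (n := n) c A =
      ∫⁻ y in chartImage (n := n) c A, ENNReal.ofReal √(chartMetric c y).det := by
  have hm : AEMeasurable (extChartAt (𝓡 n) c).symm
      (((volume.restrict (extChartAt (𝓡 n) c).target).withDensity
        (fun y => ENNReal.ofReal √(chartMetric c y).det))) :=
    ((continuousOn_extChartAt_symm (I := 𝓡 n) c).aemeasurable
      (isOpen_extChartAt_target (I := 𝓡 n) c).measurableSet).mono_ac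
        (withDensity_absolutelyContinuous _ _)
  rw [chartVolume, Measure.map_apply_of_aemeasurable hm hA, withDensity_apply',
    Measure.restrict_restrict' (isOpen_extChartAt_target (I := 𝓡 n) c).measurableSet]
  rfl

/-- Change of variables along the transition map. The inequality is enough to bound the supremum
defining the volume. -/
lemma chartVolume_le (c d : M) {A : Set M} (hA : MeasurableSet A)
    (hAd : A ⊆ (extChartAt (𝓡 n) d).source) :
    chartVolume (n := n) c A ≤ chartVolume (n := n) d A := by
  rw [chartVolume_apply c hA, chartVolume_apply d hA]
  have hS := measurableSet_chartImage (n := n) c hA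
  have hsub : chartImage c A ⊆ transitionDomain (n := n) c d := fun y hy => ⟨hy.2, hAd hy.1⟩
  have hiso := isIsometryOn_transition (n := n) c d
  have hinj : Set.InjOn (transition (n := n) c d) (chartImage c A) := by
    intro y hy z hz hyz
    have h1 := congrArg (extChartAt (𝓡 n) d).symm hyz
    rw [symm_transition (hsub hy), symm_transition (hsub hz)] at h1
    exact (extChartAt (𝓡 n) c).symm.injOn hy.2 hz.2 h1
  have hder : ∀ y ∈ chartImage c A, HasFDerivWithinAt (transition (n := n) c d)
      (fderiv ℝ (transition c d) y) (chartImage c A) y := fun y hy =>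
    (differentiableAt_of_contDiffOn hiso.isOpen hiso.contDiffOn
      (hsub hy)).hasFDerivAt.hasFDerivWithinAt
  have hcv := lintegral_image_eq_lintegral_abs_det_fderiv_mul volume hS hder hinj
    (fun y => ENNReal.ofReal √(chartMetric d y).det)
  have himg : transition c d '' chartImage c A ⊆ chartImage (n := n) d A := by
    rintro _ ⟨y, hy, rfl⟩
    refine ⟨?_, mapsTo_transition c d (hsub hy)⟩
    rw [Set.mem_preimage, symm_transition (hsub hy)]
    exact hy.1
  calc ∫⁻ y in chartImage (n := n) c A, ENNReal.ofReal √(chartMetric c y).det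
      = ∫⁻ y in chartImage (n := n) c A, ENNReal.ofReal |(fderiv ℝ (transition c d) y).det| *
          ENNReal.ofReal √(chartMetric d (transition c d y)).det := by
        refine setLIntegral_congr_fun hS fun y hy => ?_
        rw [← ENNReal.ofReal_mul (abs_nonneg _), hiso.sqrt_det (hsub hy)]
    _ = _ := hcv.symm
    _ ≤ _ := lintegral_mono_set himg

lemma riemannianVolume_le_chartVolume (d : M) {A : Set M} (hA : MeasurableSet A)
    (hAd : A ⊆ (extChartAt (𝓡 n) d).source) :
    riemannianVolume n M A ≤ chartVolume (n := n) d A := by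
  -- A supremum of measures is not computed setwise, so a dominating measure is exhibited: it agrees
  -- with the volume of the chart at d inside A and is infinite on any measurable set leaving A.
  set ν : Measure M := chartVolume (n := n) d + (⊤ : ℝ≥0∞) • Measure.count.restrict Aᶜ with hν
  have hle : riemannianVolume n M ≤ ν := by
    refine iSup_le fun c => Measure.le_iff.2 fun B hB => ?_
    by_cases hBA : B ⊆ A
    · refine (chartVolume_le c d hB (hBA.trans hAd)).trans ?_
      rw [hν, Measure.add_apply]
      exact le_self_add
    · obtain ⟨x, hxB, hxA⟩ := Set.not_subset.1 hBA
      have h1 : (Measure.count.restrict Aᶜ) B ≠ 0 := by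
        rw [Measure.restrict_apply hB]
        exact Measure.count_ne_zero ⟨x, hxB, hxA⟩
      have h2 : ν B = ⊤ := by
        rw [hν, Measure.add_apply, Measure.smul_apply, smul_eq_mul, ENNReal.top_mul h1, add_top]
      rw [h2]
      exact le_top
  refine (hle A).trans ?_
  rw [hν, Measure.add_apply, Measure.smul_apply, Measure.restrict_apply hA, Set.inter_compl_self,
    measure_empty, smul_zero, add_zero]

lemma continuousOn_sqrt_det (c : M) :
    ContinuousOn (fun y => √(chartMetric (n := n) c y).det) (extChartAt (𝓡 n) c).target :=
  Real.continuous_sqrt.comp_continuousOn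
    (contDiffOn_det (isMetricOn_chartMetric c).contDiffOn).continuousOn

instance isLocallyFiniteMeasure_riemannianVolume :
    IsLocallyFiniteMeasure (riemannianVolume n M) := by
  refine ⟨fun d => ?_⟩
  obtain ⟨K, hK, hKsub, hKc⟩ := local_compact_nhds
    ((isOpen_extChartAt_target (I := 𝓡 n) d).mem_nhds (mem_extChartAt_target (I := 𝓡 n) d))
  set V : Set M := (extChartAt (𝓡 n) d).source ∩ extChartAt (𝓡 n) d ⁻¹' interior K with hV
  have hVo : IsOpen V :=
    (continuousOn_extChartAt d).isOpen_inter_preimage (isOpen_extChartAt_source d)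
      isOpen_interior
  refine ⟨V, hVo.mem_nhds ⟨mem_extChartAt_source d, mem_interior_iff_mem_nhds.2 hK⟩, ?_⟩
  refine (riemannianVolume_le_chartVolume d hVo.measurableSet Set.inter_subset_left).trans_lt ?_
  rw [chartVolume_apply d hVo.measurableSet]
  have hsub : chartImage (n := n) d V ⊆ K := by
    intro y hy
    have h1 := interior_subset hy.1.2
    rwa [(extChartAt (𝓡 n) d).right_inv hy.2] at h1
  obtain ⟨C, hC⟩ := hKc.exists_bound_of_continuousOn ((continuousOn_sqrt_det d).mono hKsub)
  calc ∫⁻ y in chartImage (n := n) d V, ENNReal.ofReal √(chartMetric d y).det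
      ≤ ∫⁻ y in K, ENNReal.ofReal √(chartMetric d y).det := lintegral_mono_set hsub
    _ ≤ ∫⁻ _ in K, ENNReal.ofReal C := by
        refine setLIntegral_mono' hKc.measurableSet fun y hy => ENNReal.ofReal_le_ofReal ?_
        exact (le_abs_self _).trans (hC y hy)
    _ = ENNReal.ofReal C * volume K := by rw [setLIntegral_const]
    _ < ⊤ := ENNReal.mul_lt_top ENNReal.ofReal_lt_top hKc.measure_lt_top

instance isOpenPosMeasure_riemannianVolume :
    (riemannianVolume n M).IsOpenPosMeasure := by
  refine ⟨fun U hU ⟨c, hc⟩ h0 => ?_⟩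
  have h1 : chartVolume (n := n) c U = 0 :=
    le_antisymm (h0 ▸ (le_iSup (fun c : M => chartVolume (n := n) c) c) U) zero_le
  rw [chartVolume_apply c hU.measurableSet] at h1
  have hS := isOpen_chartImage (n := n) c hU
  have hm : AEMeasurable (fun y => ENNReal.ofReal √(chartMetric (n := n) c y).det)
      (volume.restrict (chartImage c U)) :=
    (((continuousOn_sqrt_det c).mono Set.inter_subset_right).aemeasurable
      hS.measurableSet).ennreal_ofReal
  rw [lintegral_eq_zero_iff' hm] at h1
  have h2 := ae_iff.1 ((ae_restrict_iff' hS.measurableSet).1 h1)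
  -- On the image of the chart the density is strictly positive, so a null integral forces an open
  -- set to be Lebesgue null.
  have h3 : volume (chartImage (n := n) c U) = 0 := by
    refine measure_mono_null (fun y hy => fun hy0 => ?_) h2
    have h4 := (ENNReal.ofReal_eq_zero.1 (hy0 hy))
    exact absurd h4 (not_le.2 (Real.sqrt_pos.2 (posDef_chartMetric c hy.2).det_pos))
  refine (hS.measure_pos volume ⟨extChartAt (𝓡 n) c c, ?_, mem_extChartAt_target c⟩).ne' h3
  rw [Set.mem_preimage, extChartAt_to_inv]
  exact hc

end RiemannManifold

/-! ### Complete locally compact length spaces are proper -/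

section HopfRinow

open Metric

variable {X : Type*} [MetricSpace X]

/-- A metric space with approximate intermediate points. -/
def HasIntermediatePoints (X : Type*) [MetricSpace X] : Prop :=
  ∀ (x y : X) (a b : ℝ), 0 < a → 0 < b → dist x y < a + b → ∃ w, dist x w ≤ a ∧ dist w y < b

/-- The Hopf-Rinow theorem for length spaces. -/
theorem HasIntermediatePoints.isCompact_closedBall [CompleteSpace X] [LocallyCompactSpace X]
    (h : HasIntermediatePoints X) (x : X) (r : ℝ) : IsCompact (closedBall x r) := by
  by_contra hr
  set S : Set ℝ := {t | IsCompact (closedBall x t)} with hS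
  have hdown : ∀ {t s}, t ∈ S → s ≤ t → s ∈ S := fun ht hst =>
    ht.of_isClosed_subset isClosed_closedBall (closedBall_subset_closedBall hst)
  have hbdd : BddAbove S := ⟨r, fun t ht => le_of_not_ge fun hlt => hr (hdown ht hlt)⟩
  obtain ⟨t₀, ht₀, ht₀c⟩ : ∃ t, 0 < t ∧ t ∈ S := by
    obtain ⟨K, hKc, hK⟩ := exists_compact_mem_nhds x
    obtain ⟨t, ht, htK⟩ := nhds_basis_closedBall.mem_iff.1 hK
    exact ⟨t, ht, hKc.of_isClosed_subset isClosed_closedBall htK⟩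
  -- R is the supremum of the radii with compact closed ball. It is shown to be attained, then to be
  -- exceeded.
  set R := sSup S with hR
  have hRpos : 0 < R := ht₀.trans_le (le_csSup hbdd ht₀c)
  have hlt : ∀ t < R, t ∈ S := fun t ht => by
    obtain ⟨s, hs, hts⟩ := exists_lt_of_lt_csSup ⟨t₀, ht₀c⟩ ht
    exact hdown hs hts.le
  have hRS : R ∈ S := by
    refine isCompact_iff_totallyBounded_isComplete.2
      ⟨totallyBounded_iff.2 fun ε hε => ?_, isClosed_closedBall.isComplete⟩
    -- A radius below R, hence with compact ball, yet within ε/4 of R, so that intermediate points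
    -- bring each point of the R-ball within ε/2 of it. The maximum with R/2 keeps it positive.
    set a := max (R - ε / 4) (R / 2) with ha
    have haR : a < R := max_lt (by linarith) (by linarith)
    obtain ⟨T, hT, hcov⟩ := totallyBounded_iff.1 (hlt a haR).totallyBounded (ε / 2) (by linarith)
    refine ⟨T, hT, fun y hy => ?_⟩
    have hxy : dist x y < a + ε / 2 := by
      have h1 : R - ε / 4 ≤ a := le_max_left _ _
      have h2 : dist x y ≤ R := by rw [dist_comm]; exact hy
      linarith
    obtain ⟨w, hw1, hw2⟩ := h x y a (ε / 2)
      (lt_of_lt_of_le (by linarith) (le_max_right (R - ε / 4) (R / 2))) (by linarith) hxy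
    have hw : w ∈ closedBall x a := by rw [mem_closedBall, dist_comm]; exact hw1
    obtain ⟨c, hc, hwc⟩ := Set.mem_iUnion₂.1 (hcov hw)
    refine Set.mem_iUnion₂.2 ⟨c, hc, ?_⟩
    rw [mem_ball] at hwc ⊢
    have := dist_triangle y w c
    rw [dist_comm y w] at this
    linarith
  obtain ⟨K, hK, hsub⟩ := exists_compact_superset hRS
  obtain ⟨δ, hδ, hthick⟩ := IsCompact.exists_thickening_subset_open hRS isOpen_interior hsub
  -- Intermediate points place the ball of radius R + δ/2 in the δ-thickening of the R-ball, which
  -- lies in the compact set K; this contradicts the choice of R.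
  have hmem : R + δ / 2 ∈ S := by
    refine hK.of_isClosed_subset isClosed_closedBall fun y hy => interior_subset (hthick ?_)
    have h2 : dist x y ≤ R + δ / 2 := by rw [dist_comm]; exact hy
    obtain ⟨w, hw1, hw2⟩ := h x y R δ hRpos hδ (by linarith)
    refine mem_thickening_iff.2 ⟨w, ?_, ?_⟩
    · rw [mem_closedBall, dist_comm]
      exact hw1
    · rw [dist_comm]
      exact hw2
  have := le_csSup hbdd hmem
  linarith

end HopfRinow

/-! ### Complete Riemannian manifolds as proper length spaces -/

namespace RiemannManifold

open Manifold Set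

variable {n : ℕ} {M : Type*} [MetricSpace M] [ChartedSpace (EuclideanSpace ℝ (Fin n)) M]
  [RiemannianBundle (fun x : M => TangentSpace (𝓡 n) x)]
  [IsRiemannianManifold (𝓡 n) M]

lemma exists_curve {x y : M} {s : ℝ} (h : dist x y < s) :
    ∃ γ : ℝ → M, γ 0 = x ∧ γ 1 = y ∧ ContMDiff 𝓘(ℝ, ℝ) (𝓡 n) 1 γ ∧
      pathELength (𝓡 n) γ 0 1 < ENNReal.ofReal s := by
  have h1 : riemannianEDist (𝓡 n) x y < ENNReal.ofReal s := by
    rw [← IsRiemannianManifold.out (I := 𝓡 n) x y, edist_dist]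
    exact (ENNReal.ofReal_lt_ofReal_iff (dist_nonneg.trans_lt h)).2 h
  obtain ⟨γ, h0, h1, hγ, hl, -⟩ :=
    exists_lt_locally_constant_of_riemannianEDist_lt h1 (zero_lt_one (α := ℝ))
  exact ⟨γ, h0, h1, hγ, hl⟩

lemma edist_curve_le {γ : ℝ → M} (hγ : ContMDiff 𝓘(ℝ, ℝ) (𝓡 n) 1 γ) {a b : ℝ} (hab : a ≤ b) :
    edist (γ a) (γ b) ≤ pathELength (𝓡 n) γ a b := by
  rw [IsRiemannianManifold.out (I := 𝓡 n) (γ a) (γ b)]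
  exact riemannianEDist_le_pathELength hγ.contMDiffOn rfl rfl hab

/-- On a curve of length less than a + b, the intermediate value theorem gives a point at distance
exactly a from x; the remaining arc is shorter than b. -/
lemma hasIntermediatePoints (n : ℕ) (M : Type*) [MetricSpace M]
    [ChartedSpace (EuclideanSpace ℝ (Fin n)) M]
    [RiemannianBundle (fun x : M => TangentSpace (𝓡 n) x)]
    [IsRiemannianManifold (𝓡 n) M] : HasIntermediatePoints M := by
  intro x y a b ha hb hxy
  rcases le_or_gt (dist x y) a with hle | hgt
  · exact ⟨y, hle, by simpa using hb⟩
  obtain ⟨γ, rfl, rfl, hγ, hl⟩ := exists_curve (n := n) hxy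
  have hcont : ContinuousOn (fun t => dist (γ 0) (γ t)) (Icc 0 1) :=
    (continuous_const.dist hγ.continuous).continuousOn
  obtain ⟨t, ht, hta⟩ := intermediate_value_Icc zero_le_one hcont
    (show a ∈ Icc _ _ from ⟨by simpa using ha.le, hgt.le⟩)
  simp only at hta
  refine ⟨γ t, hta.le, ?_⟩
  rw [← pathELength_add ht.1 ht.2] at hl
  have h1 := (add_le_add (edist_curve_le hγ ht.1) (edist_curve_le hγ ht.2)).trans_lt hl
  rw [edist_dist, edist_dist, ← ENNReal.ofReal_add dist_nonneg dist_nonneg,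
    ENNReal.ofReal_lt_ofReal_iff (by linarith), hta] at h1
  linarith

/-- Closed balls of a complete Riemannian manifold are compact. -/
lemma isCompact_closedBall (n : ℕ) {M : Type*} [MetricSpace M]
    [ChartedSpace (EuclideanSpace ℝ (Fin n)) M]
    [RiemannianBundle (fun x : M => TangentSpace (𝓡 n) x)]
    [IsRiemannianManifold (𝓡 n) M] [CompleteSpace M] (x : M) (r : ℝ) :
    IsCompact (Metric.closedBall x r) :=
  have := Manifold.locallyCompact_of_finiteDimensional (M := M) (𝓡 n)
  (hasIntermediatePoints n M).isCompact_closedBall x r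

end RiemannManifold

namespace RiemannManifold

open Manifold Set

variable {n : ℕ} {M : Type*} [MetricSpace M] [ChartedSpace (EuclideanSpace ℝ (Fin n)) M]
  [IsManifold (𝓡 n) ∞ M] [RiemannianBundle (fun x : M => TangentSpace (𝓡 n) x)]
  [IsContMDiffRiemannianBundle (𝓡 n) ∞ (EuclideanSpace ℝ (Fin n))
    (fun x : M => TangentSpace (𝓡 n) x)]

/-! ### The gradient estimate for the curvature norm -/

lemma continuous_norm_mfderiv {γ : ℝ → M} (hγ : ContMDiff 𝓘(ℝ, ℝ) (𝓡 n) 1 γ) :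
    Continuous fun t => ‖mfderiv 𝓘(ℝ, ℝ) (𝓡 n) γ t 1‖ := by
  have h1 : ContMDiff 𝓘(ℝ, ℝ).tangent (𝓡 n).tangent 0 (tangentMap 𝓘(ℝ, ℝ) (𝓡 n) γ) :=
    hγ.contMDiff_tangentMap (by simp)
  have h2 : ContMDiff 𝓘(ℝ, ℝ) 𝓘(ℝ, ℝ).tangent 0
      (fun t : ℝ => (⟨t, (1 : ℝ)⟩ : TangentBundle 𝓘(ℝ, ℝ) ℝ)) := by
    rw [← contMDiffOn_univ]
    exact contMDiffOn_vectorSpace_iff_contDiffOn.2 contDiffOn_const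
  have h3 : ContMDiff 𝓘(ℝ, ℝ) (𝓡 n).tangent 0
      (fun t : ℝ => (⟨γ t, mfderiv 𝓘(ℝ, ℝ) (𝓡 n) γ t 1⟩ : TangentBundle (𝓡 n) M)) := h1.comp h2
  have : IsContMDiffRiemannianBundle (𝓡 n) 0 (EuclideanSpace ℝ (Fin n))
      (fun x : M => TangentSpace (𝓡 n) x) := IsContMDiffRiemannianBundle.of_le (n := ∞) (by simp)
  have h4 := (ContMDiff.inner_bundle h3 h3).continuous
  simp only [norm_eq_sqrt_real_inner]
  exact Real.continuous_sqrt.comp h4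

/-- If `|∇Rm| ≤ L` along a curve, then `|Rm|` decreases along it by at most `L` times its
length. -/
lemma rmNorm_le_add_mul_integral {γ : ℝ → M} (hγ : ContMDiff 𝓘(ℝ, ℝ) (𝓡 n) 1 γ) {L : ℝ}
    (hL : ∀ t ∈ Icc (0 : ℝ) 1, nablaRmNorm (n := n) 1 (γ t) ≤ L) :
    rmNorm (n := n) (γ 0) ≤ rmNorm (n := n) (γ 1) +
      L * ∫ t in (0 : ℝ)..1, ‖mfderiv 𝓘(ℝ, ℝ) (𝓡 n) γ t 1‖ := by
  set φ : ℝ → ℝ := fun t => ‖mfderiv 𝓘(ℝ, ℝ) (𝓡 n) γ t 1‖ with hφ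
  have hφc : Continuous φ := continuous_norm_mfderiv hγ
  set f : ℝ → ℝ := fun t => rmNorm (n := n) (γ t) with hf
  have hf0 : ∀ t, 0 ≤ f t := fun t => rmNorm_nonneg _
  have hfc : Continuous f := continuous_rmNorm.comp hγ.continuous
  -- |Rm| need not be differentiable where it vanishes, so √(|Rm|² + δ²) is used and δ is arbitrary.
  refine le_of_forall_pos_le_add fun δ hδ => ?_
  have hpos : ∀ t, 0 < f t ^ 2 + δ ^ 2 := fun t => by positivity
  choose d hd hdle using fun t => exists_hasDerivAt_rmNorm_sq (n := n) (γ := γ) (t := t)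
    (hγ.mdifferentiableAt one_ne_zero)
  have hder : ∀ t, HasDerivAt (fun t => -√(f t ^ 2 + δ ^ 2)) (-(d t / (2 * √(f t ^ 2 + δ ^ 2)))) t :=
    fun t => (((hd t).add_const (δ ^ 2)).sqrt (hpos t).ne').neg
  -- The comparison bounds increments from above; the minus sign turns it into a bound on the
  -- decrease from time 0 to time 1.
  have hint := intervalIntegral.sub_le_integral_of_hasDeriv_right_of_le (zero_le_one' ℝ)
    (g := fun t => -√(f t ^ 2 + δ ^ 2)) (φ := fun t => L * φ t)
    (by fun_prop) (fun t _ => (hder t).hasDerivWithinAt)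
    ((continuous_const.mul hφc).continuousOn.integrableOn_Icc) (fun t ht => by
      have hsq : 0 < √(f t ^ 2 + δ ^ 2) := Real.sqrt_pos.2 (hpos t)
      have h1 : f t ≤ √(f t ^ 2 + δ ^ 2) :=
        Real.le_sqrt_of_sq_le (le_add_of_nonneg_right (sq_nonneg δ))
      have h2 : nablaRmNorm (n := n) 1 (γ t) * φ t ≤ L * φ t :=
        mul_le_mul_of_nonneg_right (hL t ⟨ht.1.le, ht.2.le⟩) (norm_nonneg _)
      have h0 : 0 ≤ nablaRmNorm (n := n) 1 (γ t) * φ t :=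
        mul_nonneg (RiemannCoord.tensorNorm_nonneg _ _) (norm_nonneg _)
      rw [← neg_div, div_le_iff₀ (by positivity)]
      calc -d t ≤ |d t| := neg_le_abs _
        _ ≤ 2 * (f t * (nablaRmNorm (n := n) 1 (γ t) * φ t)) := hdle t
        _ ≤ 2 * (√(f t ^ 2 + δ ^ 2) * (L * φ t)) := by gcongr
        _ = _ := by ring)
  rw [intervalIntegral.integral_const_mul] at hint
  have e0 : f 0 ≤ √(f 0 ^ 2 + δ ^ 2) :=
    Real.le_sqrt_of_sq_le (le_add_of_nonneg_right (sq_nonneg δ))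
  have e1 : √(f 1 ^ 2 + δ ^ 2) ≤ f 1 + δ :=
    Real.sqrt_le_iff.2 ⟨by linarith [hf0 1], by nlinarith [hf0 1]⟩
  linarith

variable [IsRiemannianManifold (𝓡 n) M]

/-- If `|∇Rm| ≤ L` on `B(y, s)`, then `|Rm| ≥ |Rm|(y) - L s` on `B(y, s)`. -/
lemma rmNorm_le_add_mul {y w : M} {s L : ℝ} (hL0 : 0 ≤ L)
    (hL : ∀ z ∈ Metric.ball y s, nablaRmNorm (n := n) 1 z ≤ L) (hw : w ∈ Metric.ball y s) :
    rmNorm (n := n) y ≤ rmNorm (n := n) w + L * s := by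
  have hs : 0 < s := Metric.pos_of_mem_ball hw
  obtain ⟨γ, rfl, rfl, hγ, hl⟩ := exists_curve (n := n) (x := y) (y := w) (s := s)
    (by rw [dist_comm]; exact hw)
  have hφc := continuous_norm_mfderiv hγ
  -- A curve of length less than s starting at y never leaves B(y, s), so the gradient bound holds
  -- along all of it.
  have hmem : ∀ t ∈ Icc (0 : ℝ) 1, γ t ∈ Metric.ball (γ 0) s := fun t ht => by
    have h1 : edist (γ 0) (γ t) < ENNReal.ofReal s :=
      ((edist_curve_le hγ ht.1).trans (pathELength_mono le_rfl ht.2)).trans_lt hl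
    rw [edist_dist, ENNReal.ofReal_lt_ofReal_iff hs] at h1
    rwa [Metric.mem_ball, dist_comm]
  have hint : ∫ t in (0 : ℝ)..1, ‖mfderiv 𝓘(ℝ, ℝ) (𝓡 n) γ t 1‖ < s := by
    rw [intervalIntegral.integral_of_le zero_le_one, ← integral_Icc_eq_integral_Ioc,
      ← ENNReal.ofReal_lt_ofReal_iff hs,
      ofReal_integral_eq_lintegral_ofReal hφc.continuousOn.integrableOn_Icc
        (Filter.Eventually.of_forall fun t => norm_nonneg _)]
    rw [pathELength_eq_lintegral_mfderiv_Icc] at hl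
    simpa only [ofReal_norm] using hl
  have h := rmNorm_le_add_mul_integral hγ (L := L) fun t ht => hL _ (hmem t ht)
  have := mul_le_mul_of_nonneg_left hint.le hL0
  linarith

/-! ### The scale-invariant curvature integral -/

variable [CompleteSpace M] [MeasurableSpace M] [BorelSpace M]

/-- A lower bound for `|Rm|` on a ball gives a lower bound for `curvatureSup`. -/
lemma ofReal_le_curvatureSup {p : ℝ} (hp : 0 < p) {x y : M} {r s a : ℝ} (hs : 0 < s)
    (hsub : Metric.ball y s ⊆ Metric.ball x r) (ha : 0 ≤ a)
    (hf : ∀ z ∈ Metric.ball y s, a ≤ rmNorm (n := n) z) :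
    ENNReal.ofReal (s ^ 2 * a) ≤ curvatureSup n p x r := by
  set V := riemannianVolume n M (Metric.ball y s) with hV
  -- Positivity and finiteness of the volume are what permit cancelling it in the average.
  have hV0 : V ≠ 0 := (Metric.isOpen_ball.measure_pos _ ⟨y, Metric.mem_ball_self hs⟩).ne'
  have hVtop : V ≠ ⊤ := ((measure_mono Metric.ball_subset_closedBall).trans_lt
    (isCompact_closedBall n y s).measure_lt_top).ne
  have hint : ENNReal.ofReal (a ^ p) * V ≤
      ∫⁻ z in Metric.ball y s, ENNReal.ofReal (rmNorm (n := n) z ^ p) ∂(riemannianVolume n M) := by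
    rw [← setLIntegral_const]
    refine setLIntegral_mono' Metric.isOpen_ball.measurableSet fun z hz => ?_
    exact ENNReal.ofReal_le_ofReal (Real.rpow_le_rpow ha (hf z hz) hp.le)
  have hle : (ENNReal.ofReal (s ^ (2 * p)) / V *
      ∫⁻ z in Metric.ball y s, ENNReal.ofReal (rmNorm (n := n) z ^ p) ∂(riemannianVolume n M))
        ^ (1 / p) ≤ curvatureSup n p x r :=
    le_iSup_of_le y (le_iSup_of_le s (le_iSup_of_le hs (le_iSup_of_le hsub le_rfl)))
  refine le_trans ?_ hle
  have h1 : ENNReal.ofReal ((s ^ 2 * a) ^ p) ≤ ENNReal.ofReal (s ^ (2 * p)) / V *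
      ∫⁻ z in Metric.ball y s, ENNReal.ofReal (rmNorm (n := n) z ^ p) ∂(riemannianVolume n M) := by
    refine le_trans (le_of_eq ?_) (mul_le_mul_right hint _)
    rw [Real.mul_rpow (sq_nonneg s) ha, ENNReal.ofReal_mul (by positivity), mul_comm _ V,
      ← mul_assoc, ENNReal.div_mul_cancel hV0 hVtop, ← Real.rpow_natCast_mul hs.le]
    norm_num
  refine le_trans (le_of_eq ?_) (ENNReal.rpow_le_rpow h1 (by positivity))
  rw [ENNReal.ofReal_rpow_of_nonneg (by positivity) (by positivity), ← Real.rpow_mul (by positivity),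
    mul_one_div_cancel hp.ne', Real.rpow_one]

/-! ### Point selection -/

/-- A regular manifold has `|Rm| ≥ |Rm|(y) / 2` on a ball of definite radius, if
`|Rm| ≤ 4 |Rm|(y)` on a ball `B(y, σ)` at a scale below the curvature scale. -/
lemma IsRegular.half_le_rmNorm {Λ : ℝ} (hΛ : 1 ≤ Λ) (hreg : IsRegular n M Λ 1) {y w : M} {σ : ℝ}
    (hσ : 0 < σ) (hy : 0 < rmNorm (n := n) y) (hσy : 3 * (σ * √(rmNorm (n := n) y)) ≤ 1)
    (hle : ∀ z ∈ Metric.ball y σ, rmNorm (n := n) z ≤ 4 * rmNorm (n := n) y)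
    (hw : w ∈ Metric.ball y (σ / (8 * Λ))) :
    rmNorm (n := n) y / 2 ≤ rmNorm (n := n) w := by
  set F := rmNorm (n := n) y with hF
  have hq : 0 < √F := Real.sqrt_pos.2 hy
  have hqq : √F * √F = F := Real.mul_self_sqrt hy.le
  have hrad : 2 * (σ * √F) * (1 / (2 * √F)) = σ := by field_simp
  have hrad2 : 2 * (σ * √F) / 2 * (1 / (2 * √F)) = σ / 2 := by field_simp
  have hsq : (1 / (2 * √F)) ^ 2 = 1 / (4 * F) := by
    rw [div_pow, mul_pow, Real.sq_sqrt hy.le]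
    norm_num
  -- Regularity at scale 1/(2√F) with ratio 2σ√F ≤ 2/3: the ball has radius σ, and the required
  -- curvature bound is exactly 4F.
  have h := hreg y (1 / (2 * √F)) (2 * (σ * √F)) (by positivity) (by positivity) (by linarith) (by
    rw [hrad, hsq, one_div_one_div]
    exact iSup₂_le fun z hz => ENNReal.ofReal_le_ofReal (hle z hz)) 1 le_rfl le_rfl
  rw [hrad, hrad2, hsq, pow_one] at h
  have hL : ∀ z ∈ Metric.ball y (σ / (8 * Λ)),
      nablaRmNorm (n := n) 1 z ≤ Λ / (σ * (1 / (4 * F))) := by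
    intro z hz
    have hz' : z ∈ Metric.ball y (σ / 2) := by
      refine Metric.ball_subset_ball ?_ hz
      gcongr
      linarith
    exact (ENNReal.ofReal_le_ofReal_iff (by positivity)).1 ((le_iSup₂_of_le z hz' le_rfl).trans h)
  have h2 := rmNorm_le_add_mul (n := n) (by positivity) hL hw
  -- The radius σ/(8Λ) is chosen so that the gradient bound 4ΛF/σ costs exactly half of F.
  have h3 : Λ / (σ * (1 / (4 * F))) * (σ / (8 * Λ)) = F / 2 := by
    field_simp
    norm_num
  rw [h3] at h2
  linarith

/-- Curvature bound at every point of `B(x, r)`, relative to the distance to the boundary. -/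
lemma IsRegular.sq_mul_rmNorm_le {Λ : ℝ} (hΛ : 1 ≤ Λ) (hreg : IsRegular n M Λ 1) {p : ℝ}
    (hp : 0 < p) {x : M} {r m : ℝ} (hr : 0 < r) (hm0 : 0 ≤ m)
    (hm : curvatureSup n p x r ≤ ENNReal.ofReal m) (hmΛ : 2000 * Λ ^ 2 * m ≤ 1) {y : M}
    (hy : y ∈ Metric.ball x r) :
    (r - dist y x) ^ 2 * rmNorm (n := n) y ≤ 512 * Λ ^ 2 * m := by
  have hcont : Continuous fun z : M => (r - dist z x) ^ 2 * rmNorm (n := n) z :=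
    ((continuous_const.sub (continuous_id.dist continuous_const)).pow 2).mul continuous_rmNorm
  -- The weight vanishes on the sphere of radius r, so a maximum point with positive value lies in
  -- the open ball.
  obtain ⟨c, hc, hmax⟩ := (isCompact_closedBall n x r).exists_isMaxOn
    ⟨x, Metric.mem_closedBall_self hr.le⟩ hcont.continuousOn
  refine (hmax (Metric.ball_subset_closedBall hy)).trans ?_
  by_contra! hlt
  set F := rmNorm (n := n) c with hF
  set ρ := r - dist c x with hρ
  have hρ0 : 0 ≤ ρ := sub_nonneg.2 hc
  have hpos : 0 < ρ ^ 2 * F := lt_of_le_of_lt (by positivity) hlt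
  have hFpos : 0 < F := pos_of_mul_pos_right hpos (sq_nonneg _)
  have hρpos : 0 < ρ := lt_of_le_of_ne hρ0 fun h => by simp [← h] at hpos
  have hq : 0 < √F := Real.sqrt_pos.2 hFpos
  -- The bound ρ/2 keeps the weight comparable to ρ on B(c, σ); the bound 1/(3√F) stays below the
  -- curvature scale, so that regularity applies.
  set σ := min (ρ / 2) (1 / (3 * √F)) with hσ
  have hσpos : 0 < σ := lt_min (by positivity) (by positivity)
  have hσρ : σ ≤ ρ / 2 := min_le_left _ _
  have hσF : 3 * (σ * √F) ≤ 1 := by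
    have h1 : σ * (3 * √F) ≤ 1 := (le_div_iff₀ (by positivity)).1 (min_le_right _ _)
    linarith
  have hfar : ∀ z ∈ Metric.ball c σ, ρ / 2 ≤ r - dist z x := fun z hz => by
    have h1 := dist_triangle z c x
    have h2 : dist z c < σ := hz
    linarith
  have hle : ∀ z ∈ Metric.ball c σ, rmNorm (n := n) z ≤ 4 * F := fun z hz => by
    have h1 := hfar z hz
    have h2 : (r - dist z x) ^ 2 * rmNorm (n := n) z ≤ ρ ^ 2 * F :=
      hmax (show dist z x ≤ r by linarith)
    have h3 : (ρ / 2) ^ 2 * rmNorm (n := n) z ≤ (r - dist z x) ^ 2 * rmNorm (n := n) z :=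
      mul_le_mul_of_nonneg_right (by gcongr) (rmNorm_nonneg z)
    have h4 : ρ ^ 2 * rmNorm (n := n) z ≤ ρ ^ 2 * (4 * F) := by linarith
    exact le_of_mul_le_mul_left h4 (by positivity)
  have hhalf := fun w hw => hreg.half_le_rmNorm hΛ hσpos hFpos hσF hle (w := w) hw
  have hsub : Metric.ball c (σ / (8 * Λ)) ⊆ Metric.ball x r := fun z hz => by
    have h1 : σ / (8 * Λ) ≤ σ := div_le_self hσpos.le (by linarith)
    have h2 := hfar z (Metric.ball_subset_ball h1 hz)
    rw [Metric.mem_ball]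
    linarith
  have hlow := (ofReal_le_curvatureSup hp (by positivity) hsub (by positivity) hhalf).trans hm
  rw [ENNReal.ofReal_le_ofReal_iff hm0] at hlow
  have hΛ2 : 1 ≤ Λ ^ 2 := one_le_pow₀ hΛ
  have hlow2 : σ ^ 2 * F ≤ 128 * Λ ^ 2 * m := by
    have e : (σ / (8 * Λ)) ^ 2 * (F / 2) = σ ^ 2 * F / (128 * Λ ^ 2) := by
      field_simp
      norm_num
    rw [e, div_le_iff₀ (by positivity)] at hlow
    linarith
  -- With σ = ρ/2 the bound contradicts the assumed failure, since 4 · 128 = 512. With σ = 1/(3√F)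
  -- it gives 1/9 ≤ 128Λ²m ≤ 128/2000, which is false.
  rcases min_choice (ρ / 2) (1 / (3 * √F)) with h | h
  · rw [hσ, h] at hlow2
    linarith
  · have e : (1 / (3 * √F)) ^ 2 * F = 1 / 9 := by
      rw [div_pow, mul_pow, Real.sq_sqrt hFpos.le]
      field_simp
      norm_num
    rw [hσ, h, e] at hlow2
    linarith

end RiemannManifold

theorem theorem3p5 (Λ : ℝ) (hΛ : 1 ≤ Λ) (p : ℝ) (hp : 0 < p) :
    ∃ ε : ℝ, 0 < ε ∧
      ∀ (n : ℕ) (M : Type*) [MetricSpace M] [ChartedSpace (EuclideanSpace ℝ (Fin n)) M]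
        [IsManifold (𝓡 n) ∞ M]
        [RiemannianBundle (fun x : M => TangentSpace (𝓡 n) x)]
        [IsContMDiffRiemannianBundle (𝓡 n) ∞ (EuclideanSpace ℝ (Fin n))
          (fun x : M => TangentSpace (𝓡 n) x)]
        [IsRiemannianManifold (𝓡 n) M] [CompleteSpace M]
        [MeasurableSpace M] [BorelSpace M],
        RiemannManifold.IsRegular n M Λ 1 →
        ∀ (x : M) (r : ℝ), 0 < r →
          RiemannManifold.curvatureSup n p x r ≤ ENNReal.ofReal ε →
          (⨆ y ∈ Metric.ball x (r / 2),
              ENNReal.ofReal (RiemannManifold.rmNorm (n := n) y)) ≤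
            ENNReal.ofReal (16 / (ε * r ^ 2)) * RiemannManifold.curvatureSup n p x r := by
  have hΛ0 : 0 < Λ := by linarith
  -- Any constant above 9 · 128 = 1152 in place of 2000 would exclude the second case; neither n nor
  -- p enters.
  refine ⟨1 / (2000 * Λ ^ 2), by positivity, ?_⟩
  intro n M _ _ _ _ _ _ _ _ _ hreg x r hr hsup
  have htop : RiemannManifold.curvatureSup n p x r ≠ ⊤ :=
    (hsup.trans_lt ENNReal.ofReal_lt_top).ne
  set m := (RiemannManifold.curvatureSup n p x r).toReal with hm
  have hm0 : 0 ≤ m := ENNReal.toReal_nonneg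
  have hme : RiemannManifold.curvatureSup n p x r = ENNReal.ofReal m :=
    (ENNReal.ofReal_toReal htop).symm
  have hmΛ : 2000 * Λ ^ 2 * m ≤ 1 := by
    rw [hme, ENNReal.ofReal_le_ofReal_iff (by positivity), le_div_iff₀ (by positivity)] at hsup
    linarith
  rw [hme, ← ENNReal.ofReal_mul (by positivity)]
  refine iSup₂_le fun y hy => ENNReal.ofReal_le_ofReal ?_
  have hy' : dist y x < r / 2 := hy
  have h := hreg.sq_mul_rmNorm_le hΛ hp hr hm0 hme.le hmΛ
    (y := y) (show dist y x < r by linarith)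
  -- This gives |Rm| ≤ 2048Λ²m/r², well within the claimed 16m/(εr²) = 32000Λ²m/r².
  have h1 : (r / 2) ^ 2 * RiemannManifold.rmNorm (n := n) y ≤ 512 * Λ ^ 2 * m := by
    refine le_trans (mul_le_mul_of_nonneg_right ?_ (RiemannManifold.rmNorm_nonneg y)) h
    gcongr
    linarith
  rw [show 16 / (1 / (2000 * Λ ^ 2) * r ^ 2) * m = Λ ^ 2 * m * 32000 / r ^ 2 by
    field_simp
    ring, le_div_iff₀ (by positivity)]
  have h2 : 0 ≤ Λ ^ 2 * m := by positivity
  linarith
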